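/- **Setting.** Consider a feed-forward network with $L$ layers, weight matrices $\mathbf A^l\in\mathbb R^{d_1^l\times d_2^l}$ ($1\le l\le L$, $d_2^l=d_1^{l-1}$, where $d_1^0$ is the input dimension) and activations $\phi_l:\mathbb R^{d_1^l}\to\mathbb R^{d_1^l}$ ($1\le l\le L-1$), where $\phi_l$ is $L_l$-Lipschitz for the Euclidean norm and $\phi_l(0)=0$. On input $x$ put $x^0=x$, $x^1=\mathbf A^1x$, $x^{l}=\mathbf A^{l}\phi_{l-1}(x^{l-1})$ for $2\le l\le L$; the output is $x^L$. There is no activation after the last layer, and $L_L:=1$. Write $\|\cdot\|_2$ for the Euclidean norm of vectors and for the spectral (operator) norm of matrices. Let $\Psi>0$ and $d>0$. The weights are random: within each layer the entries $\mathbf A^l_{ij}$ are i.i.d. $\mathcal N(0,\Psi)$. The pruned matrix $\hat{\mathbf A}^l$ is obtained by replacing each off-diagonal entry $\mathbf A^l_{ij}$ ($i\ne j$) by $0$ with probability $\exp(-(\mathbf A^l_{ij})^2/(d\Psi))$ given its value, independently over the entries of the layer; diagonal entries are kept. No independence between different layers is required. Let $J_l$ be the number of nonzero entries of $\hat{\mathbf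 A}^l$. For $\rho_l>0$ let $\tilde{\mathbf A}^l$ be $\hat{\mathbf A}^l$ with every entry rounded to the nearest multiple of $\rho_l$ (ties are rounded up), and let $\tilde x^L$ be the output on input $x$ of the network with weights $\tilde{\mathbf A}^1,\dots,\tilde{\mathbf A}^L$ and the same activations. **Lemma.** There is a universal constant $C>0$ such that, with $$\Gamma_l = C\left[\sqrt{\frac{d^{3/2}\Psi}{(d+2)^{3/2}}}\left(\sqrt{d_1^l}+\sqrt{d_2^l}\right)+\left(\frac{3d_1^ld_2^ld^{5/2}\Psi^2}{(d+2)^{5/2}}\right)^{1/4}\right],$$ the following holds in every such setting. 1. For every layer $l$ and every $\rho_l>0$ (and every realization of the weights and of the pruning), $\|\tilde{\mathbf A}^l-\hat{\mathbf A}^l\|_2\le\rho_lJ_l$. 2. Let $\epsilon_1,\dots,\epsilon_L>0$. With probability at least $1-\sum_{l=1}^L\epsilon_l^{-1}$, simultaneously for all $\rho_1,\dots,\rho_L>0$ satisfying $$\rho_l\le\frac{\frac1L\|\mathbf A^l\|_2-\epsilon_l\Gamma_l}{J_l}\qquad(1\le l\le L)$$ (in particular $J_l\ge 1$; the $\rho_l$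 may depend on the realization) and for all inputs $x\in\mathbb R^{d_1^0}$ with $\|x\|_2\le d_1^0$, $$\|x^L-\tilde x^L\|_2\le e\,d_1^0\left(\prod_{l=1}^LL_l\|\mathbf A^l\|_2\right)\sum_{l=1}^L\frac{\epsilon_l\Gamma_l+\rho_lJ_l}{\|\mathbf A^l\|_2}.$$ -/

import Mathlib

open MeasureTheory ProbabilityTheory
open scoped NNReal Matrix.Norms.L2Operator

noncomputable section

namespace MagnitudePruning

/-- The probability `exp (-a² / (d Ψ))` with which a weight of value `a` is pruned. -/
def pruneProb (d Ψ : ℝ≥0) (a : ℝ) : unitInterval :=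
  ⟨Real.exp (-a ^ 2 / ((d : ℝ) * (Ψ : ℝ))), (Real.exp_pos _).le, by
    rw [Real.exp_le_one_iff, neg_div, neg_nonpos]
    positivity⟩

lemma continuous_pruneProb (d Ψ : ℝ≥0) : Continuous (pruneProb d Ψ) := by
  unfold pruneProb
  fun_prop

/-- Given the value `a` of a weight, the law of its pruning indicator: `true` (prune) with
probability `exp (-a² / (d Ψ))`, and `false` (keep) otherwise. -/
def pruneKernel (d Ψ : ℝ≥0) : Kernel ℝ Bool where
  toFun a := bernoulliMeasure true false (pruneProb d Ψ a)
  measurable' := by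
    refine Measure.measurable_of_measurable_coe _ fun s hs => ?_
    have hm := (continuous_pruneProb d Ψ).measurable
    have h1 : Measurable fun a => unitInterval.toNNReal (pruneProb d Ψ a) :=
      (unitInterval.toNNReal_continuous.measurable).comp hm
    have h2 : Measurable fun a =>
        unitInterval.toNNReal (unitInterval.symm (pruneProb d Ψ a)) :=
      (unitInterval.toNNReal_continuous.measurable).comp
        (unitInterval.continuous_symm.measurable.comp hm)
    classical
    simp only [bernoulliMeasure_apply _ hs]
    split_ifs <;> fun_prop

instance (d Ψ : ℝ≥0) : IsMarkovKernel (pruneKernel d Ψ) :=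
  ⟨fun a => inferInstanceAs
    (IsProbabilityMeasure (bernoulliMeasure true false (pruneProb d Ψ a)))⟩

/-- The joint law of a weight and its pruning indicator: the weight is `N(0, Ψ)`, and given its
value `a` the indicator is Bernoulli with parameter `exp (-a² / (d Ψ))`. -/
def weightLaw (d Ψ : ℝ≥0) : Measure (ℝ × Bool) :=
  gaussianReal 0 Ψ ⊗ₘ pruneKernel d Ψ

/-- A random layer `A` with random pruning indicators `X`: the pairs `(A i j, X i j)` are
independent over the entries `(i, j)`, and each has the law `weightLaw d Ψ`. -/
structure IsGaussianLayer {Ω : Type*} [MeasurableSpace Ω] (P : Measure Ω) (d Ψ : ℝ≥0) {m k : ℕ}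
    (A : Ω → Matrix (Fin m) (Fin k) ℝ) (X : Ω → Matrix (Fin m) (Fin k) Bool) : Prop where
  hasLaw : ∀ i j, HasLaw (fun ω => (A ω i j, X ω i j)) (weightLaw d Ψ) P
  indep : iIndepFun (fun (p : Fin m × Fin k) ω => (A ω p.1 p.2, X ω p.1 p.2)) P

/-- Magnitude-based pruning with indicators `X`: an off-diagonal entry is replaced by `0` if its
indicator is `true`; the diagonal is never pruned. -/
def prune {m k : ℕ} (A : Matrix (Fin m) (Fin k) ℝ) (X : Matrix (Fin m) (Fin k) Bool) :
    Matrix (Fin m) (Fin k) ℝ :=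
  fun i j => if (i : ℕ) ≠ (j : ℕ) ∧ X i j = true then 0 else A i j

/-- Round every entry to the nearest multiple of `ρ`. -/
def discretize {m k : ℕ} (ρ : ℝ) (B : Matrix (Fin m) (Fin k) ℝ) : Matrix (Fin m) (Fin k) ℝ :=
  fun i j => ρ * (round (B i j / ρ) : ℝ)

/-- The number of nonzero entries of a matrix. -/
def numNonzero {m k : ℕ} (B : Matrix (Fin m) (Fin k) ℝ) : ℕ :=
  {p : Fin m × Fin k | B p.1 p.2 ≠ 0}.ncard

/-- The constant `Γ` of a layer of size `d₁ × d₂`, with numerical constant `C`. -/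
def Gam (C : ℝ) (d Ψ : ℝ≥0) (d₁ d₂ : ℕ) : ℝ :=
  C * (√((d : ℝ) ^ (3 / 2 : ℝ) * Ψ / ((d : ℝ) + 2) ^ (3 / 2 : ℝ)) * (√(d₁ : ℝ) + √(d₂ : ℝ)) +
    (3 * (d₁ : ℝ) * d₂ * (d : ℝ) ^ (5 / 2 : ℝ) * (Ψ : ℝ) ^ 2 /
      ((d : ℝ) + 2) ^ (5 / 2 : ℝ)) ^ (1 / 4 : ℝ))

/-- The layer outputs of the feed-forward network with widths `n 0, n 1, …`, weight matrices
`A 0, A 1, …` and activations `φ 0, φ 1, …`: `x⁰ = x`, `x¹ = A 0 x`, `x² = A 1 (φ 0 x¹)`, and so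
on. Layers are counted from `0`, so `A l` and `φ l` are the weights and the activation of the
`(l + 1)`-st layer; the network with `L` layers has output `layerOutput A φ x L`, with no
activation after the last layer. -/
def layerOutput {n : ℕ → ℕ} (A : (l : ℕ) → Matrix (Fin (n (l + 1))) (Fin (n l)) ℝ)
    (φ : (l : ℕ) → EuclideanSpace ℝ (Fin (n (l + 1))) → EuclideanSpace ℝ (Fin (n (l + 1))))
    (x : EuclideanSpace ℝ (Fin (n 0))) : (l : ℕ) → EuclideanSpace ℝ (Fin (n l))
  | 0 => x
  | 1 => Matrix.toEuclideanLin (A 0) x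
  | l + 2 => Matrix.toEuclideanLin (A (l + 1)) (φ l (layerOutput A φ x (l + 1)))

end MagnitudePruning

end

/-! The proof splits into a deterministic part and a probabilistic part. Deterministically, if every
weight matrix moves by at most a fraction `1 / L` of its norm, each layer multiplies the error by at
most `1 + 1 / L` beyond the usual Lipschitz factor, and `(1 + 1 / L) ^ L ≤ e`; this is
`norm_output_sub_le`. The assumption on `ρ` says precisely that pruning error plus rounding error
fits in this budget once the pruning error is at most `ε Γ`. So only the latter event is random, and
the bound holds for all `ρ` and all inputs at once.

For the pruning error, the Gaussian density times the pruning probability is `p = √(d / (d + 2))`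
times a Gaussian density of variance `v = Ψ p²` (`gaussianPDFReal_mul_pruneProb`). Hence the removed
matrix, before the diagonal is spared, has independent entries `√v b g` with `b` Bernoulli(`p`) and
`g` standard normal, independent; sparing the diagonal costs a factor 2. As `Γ²` is of order at
least `v ((m + k) p + √(m k p))`, Markov's inequality reduces everything to `E‖b g‖² ≲ (m + k) p +
√(m k p)` (`lintegral_opNorm_sq_sparse_le`), where one may take `k ≤ m` by transposition.

If `k p ≤ 1`, the Gram matrix is compared with `m p` times the identity in Frobenius norm, using
only second and fourth moments. If `k p ≥ 1`, the sparsity pattern is frozen, with row and column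
counts at most `R` and `C`. A unit vector is cut into four pieces by the size of its coordinates,
and each piece is dominated, by convexity, by a vertex of the surrounding lattice cell. On pieces
with small coordinates a row of the masked matrix has small variance; pieces with large coordinates
live on few coordinates, so their net is small. Balancing the two gives `C + R / r³ + k r⁵` with `r
= p^(1/10)` (`lintegral_opNorm_sq_maskMatrix_le`). The expected maximal counts are then of order
`log k + p m` and `log m + p k`.

Maxima are handled in expectation rather than through tails: since `x + 1 ≤ exp x`, each term of a
family is at most a constant plus a sum of exponentials of expectation at most 1. -/

namespace MagnitudePruning

/-! ### Operator norm estimates: entries, diagonal, rounding -/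

section OperatorNorm

variable {m k : ℕ}

lemma norm_toEuclideanLin_le (A : Matrix (Fin m) (Fin k) ℝ) (x : EuclideanSpace ℝ (Fin k)) :
    ‖Matrix.toEuclideanLin A x‖ ≤ ‖A‖ * ‖x‖ :=
  ((Matrix.toEuclideanLin.trans LinearMap.toContinuousLinearMap) A).le_opNorm x

lemma sq_opNorm_le (A : Matrix (Fin m) (Fin k) ℝ) {K : ℝ} (hK : 0 ≤ K)
    (h : ∀ v : Fin k → ℝ, ∑ j, v j ^ 2 ≤ 1 → ∑ i, (∑ j, A i j * v j) ^ 2 ≤ K) :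
    ‖A‖ ^ 2 ≤ K := by
  rw [← Real.le_sqrt (norm_nonneg _) hK, Matrix.l2_opNorm_def]
  refine ContinuousLinearMap.opNorm_le_of_unit_norm (Real.sqrt_nonneg _) fun x hx => ?_
  rw [EuclideanSpace.norm_eq]
  refine Real.sqrt_le_sqrt ?_
  have h1 : ∑ j, x j ^ 2 ≤ 1 := by
    have := EuclideanSpace.norm_sq_eq x
    rw [hx] at this
    simpa using this.symm.le
  simpa [Matrix.mulVec, dotProduct] using h x h1

lemma sum_sq_mul_le (A : Matrix (Fin m) (Fin k) ℝ) (v : Fin k → ℝ) :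
    ∑ i, (∑ j, A i j * v j) ^ 2 ≤ ‖A‖ ^ 2 * ∑ j, v j ^ 2 := by
  have h := norm_toEuclideanLin_le A (WithLp.toLp 2 v)
  have h2 := pow_le_pow_left₀ (norm_nonneg _) h 2
  rw [mul_pow, EuclideanSpace.norm_sq_eq, EuclideanSpace.norm_sq_eq] at h2
  simpa [Matrix.mulVec, dotProduct] using h2

lemma sq_opNorm_le_sum_sq (A : Matrix (Fin m) (Fin k) ℝ) : ‖A‖ ^ 2 ≤ ∑ i, ∑ j, A i j ^ 2 := by
  refine sq_opNorm_le A (by positivity) fun v hv => Finset.sum_le_sum fun i _ => ?_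
  have h0 : 0 ≤ ∑ j, A i j ^ 2 := by positivity
  calc (∑ j, A i j * v j) ^ 2 ≤ (∑ j, A i j ^ 2) * ∑ j, v j ^ 2 :=
        Finset.sum_mul_sq_le_sq_mul_sq _ _ _
    _ ≤ ∑ j, A i j ^ 2 := by nlinarith

lemma opNorm_le_sum_abs (A : Matrix (Fin m) (Fin k) ℝ) : ‖A‖ ≤ ∑ i, ∑ j, |A i j| := by
  refine le_of_sq_le_sq ?_ (by positivity)
  refine (sq_opNorm_le_sum_sq A).trans ?_
  have h1 : ∀ i, ∑ j, A i j ^ 2 ≤ (∑ j, |A i j|) ^ 2 := fun i => by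
    simpa using Finset.sum_sq_le_sq_sum_of_nonneg (s := Finset.univ) (f := fun j => |A i j|)
      fun j _ => abs_nonneg _
  refine (Finset.sum_le_sum fun i _ => h1 i).trans ?_
  exact Finset.sum_sq_le_sq_sum_of_nonneg fun i _ => by positivity

lemma abs_entry_le_opNorm (A : Matrix (Fin m) (Fin k) ℝ) (i : Fin m) (j : Fin k) :
    |A i j| ≤ ‖A‖ := by
  refine abs_le_of_sq_le_sq ?_ (norm_nonneg _)
  have h := sum_sq_mul_le A (Pi.single j 1)
  have h1 : ∑ j', (Pi.single j (1 : ℝ) : Fin k → ℝ) j' ^ 2 = 1 := by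
    simp [Pi.single_apply]
  rw [h1, mul_one] at h
  refine le_trans ?_ h
  have h2 : ∀ i, ∑ j', A i j' * (Pi.single j (1 : ℝ) : Fin k → ℝ) j' = A i j := fun i => by
    simp [Pi.single_apply]
  simp only [h2]
  exact Finset.single_le_sum (f := fun i => A i j ^ 2) (fun i _ => sq_nonneg _)
    (Finset.mem_univ i)

lemma opNorm_transpose (A : Matrix (Fin m) (Fin k) ℝ) : ‖A.transpose‖ = ‖A‖ := by
  rw [← Matrix.l2_opNorm_conjTranspose A, Matrix.conjTranspose_eq_transpose_of_trivial]

/-- The off-diagonal part of a matrix. -/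
def offDiagPart (A : Matrix (Fin m) (Fin k) ℝ) : Matrix (Fin m) (Fin k) ℝ :=
  fun i j => if (i : ℕ) ≠ (j : ℕ) then A i j else 0

/-- The diagonal part of a matrix. -/
def diagPart (A : Matrix (Fin m) (Fin k) ℝ) : Matrix (Fin m) (Fin k) ℝ :=
  fun i j => if (i : ℕ) = (j : ℕ) then A i j else 0

/-- Each row and each column contains at most one diagonal entry, and every entry is bounded by the
operator norm. -/
lemma opNorm_diagPart_le (A : Matrix (Fin m) (Fin k) ℝ) : ‖diagPart A‖ ≤ ‖A‖ := by
  refine le_of_sq_le_sq ?_ (norm_nonneg _)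
  refine sq_opNorm_le _ (by positivity) fun v hv => ?_
  have hrow : ∀ i : Fin m, (∑ j, diagPart A i j * v j) ^ 2 ≤
      ∑ j : Fin k, if (i : ℕ) = (j : ℕ) then ‖A‖ ^ 2 * v j ^ 2 else 0 := by
    intro i
    by_cases hi : (i : ℕ) < k
    · have h1 : ∀ j : Fin k, (i : ℕ) = (j : ℕ) ↔ (⟨i, hi⟩ : Fin k) = j := fun j => by
        rw [Fin.ext_iff]
      simp only [diagPart, h1, ite_mul, zero_mul, Finset.sum_ite_eq, Finset.mem_univ, if_true]
      rw [mul_pow, ← sq_abs (A i ⟨i, hi⟩)]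
      have := abs_entry_le_opNorm A i ⟨i, hi⟩
      gcongr
    · have h1 : ∀ j : Fin k, ¬ (i : ℕ) = (j : ℕ) := fun j h => hi (h ▸ j.2)
      simp [diagPart, h1]
  refine (Finset.sum_le_sum fun i _ => hrow i).trans ?_
  rw [Finset.sum_comm]
  have hcol : ∀ j : Fin k, (∑ i : Fin m, if (i : ℕ) = (j : ℕ) then ‖A‖ ^ 2 * v j ^ 2 else 0) ≤
      ‖A‖ ^ 2 * v j ^ 2 := by
    intro j
    by_cases hj : (j : ℕ) < m
    · have h1 : ∀ i : Fin m, (i : ℕ) = (j : ℕ) ↔ i = (⟨j, hj⟩ : Fin m) := fun i => by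
        rw [Fin.ext_iff]
      simp [h1]
    · have h1 : ∀ i : Fin m, ¬ (i : ℕ) = (j : ℕ) := fun i h => hj (h ▸ i.2)
      simp only [h1, if_false, Finset.sum_const_zero]
      positivity
  refine (Finset.sum_le_sum fun j _ => hcol j).trans ?_
  rw [← Finset.mul_sum]
  exact mul_le_of_le_one_right (by positivity) hv

lemma opNorm_offDiagPart_le (A : Matrix (Fin m) (Fin k) ℝ) : ‖offDiagPart A‖ ≤ 2 * ‖A‖ := by
  have hdec : offDiagPart A = A - diagPart A := by
    ext i j
    rw [Matrix.sub_apply]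
    by_cases h : (i : ℕ) = (j : ℕ) <;> simp [offDiagPart, diagPart, h]
  have h1 := opNorm_diagPart_le A
  rw [hdec]
  exact (norm_sub_le _ _).trans (by linarith)

/-- Rounding fixes zero, so only nonzero entries move, each by at most `ρ / 2`; the sum of absolute
values bounds the operator norm. -/
lemma norm_discretize_sub_le (B : Matrix (Fin m) (Fin k) ℝ) {ρ : ℝ} (hρ : 0 < ρ) :
    ‖discretize ρ B - B‖ ≤ ρ * numNonzero B := by
  classical
  refine (opNorm_le_sum_abs _).trans ?_
  have hent : ∀ i j, |(discretize ρ B - B) i j| ≤ if B i j ≠ 0 then ρ else 0 := by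
    intro i j
    rw [Matrix.sub_apply]
    by_cases h : B i j = 0
    · simp [discretize, h]
    · rw [if_pos h]
      have h1 : discretize ρ B i j - B i j = ρ * ((round (B i j / ρ) : ℝ) - B i j / ρ) := by
        simp only [discretize]
        field_simp
      rw [h1, abs_mul, abs_of_pos hρ, abs_sub_comm]
      have := abs_sub_round (B i j / ρ)
      nlinarith
  refine (Finset.sum_le_sum fun i _ => Finset.sum_le_sum fun j _ => hent i j).trans ?_
  rw [← Finset.sum_product', numNonzero, Set.ncard_eq_toFinset_card', ← Finset.sum_filter,
    Finset.sum_const, nsmul_eq_mul, mul_comm]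
  simp [Finset.univ_product_univ, Set.toFinset_ofPred]

end OperatorNorm

/-! ### Deterministic perturbation of the network -/

section Network

variable {n : ℕ → ℕ} {A B : (l : ℕ) → Matrix (Fin (n (l + 1))) (Fin (n l)) ℝ}
  {φ : (l : ℕ) → EuclideanSpace ℝ (Fin (n (l + 1))) → EuclideanSpace ℝ (Fin (n (l + 1)))}
  {Lip : ℕ → ℝ≥0} {L : ℕ}

lemma prod_lip_mul_norm_nonneg (A : (l : ℕ) → Matrix (Fin (n (l + 1))) (Fin (n l)) ℝ)
    (Lip : ℕ → ℝ≥0) (l : ℕ) : 0 ≤ ∏ i ∈ Finset.range l, (Lip i : ℝ) * ‖A i‖ :=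
  Finset.prod_nonneg fun _ _ => mul_nonneg (NNReal.coe_nonneg _) (norm_nonneg _)

lemma norm_layerOutput_le (hφ : ∀ l, l + 1 < L → LipschitzWith (Lip l) (φ l))
    (hφ0 : ∀ l, l + 1 < L → φ l 0 = 0) (x : EuclideanSpace ℝ (Fin (n 0))) :
    ∀ l, l < L → ‖layerOutput A φ x (l + 1)‖ ≤
      ‖A l‖ * (∏ i ∈ Finset.range l, (Lip i : ℝ) * ‖A i‖) * ‖x‖
  | 0, _ => by simpa [layerOutput] using norm_toEuclideanLin_le (A 0) x
  | l + 1, hl => by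
    have ih := norm_layerOutput_le hφ hφ0 x l (by omega)
    have h1 : ‖φ l (layerOutput A φ x (l + 1))‖ ≤ Lip l * ‖layerOutput A φ x (l + 1)‖ := by
      have := (hφ l hl).dist_le_mul (layerOutput A φ x (l + 1)) 0
      rwa [hφ0 l hl, dist_zero_right, dist_zero_right] at this
    rw [layerOutput, Finset.prod_range_succ]
    calc _ ≤ ‖A (l + 1)‖ * ‖φ l (layerOutput A φ x (l + 1))‖ := norm_toEuclideanLin_le _ _
      _ ≤ ‖A (l + 1)‖ * (Lip l *
          (‖A l‖ * (∏ i ∈ Finset.range l, (Lip i : ℝ) * ‖A i‖) * ‖x‖)) := by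
        have h2 := h1.trans (mul_le_mul_of_nonneg_left ih (NNReal.coe_nonneg (Lip l)))
        gcongr
      _ = _ := by ring

lemma norm_layerOutput_sub_le (hφ : ∀ l, l + 1 < L → LipschitzWith (Lip l) (φ l))
    (hφ0 : ∀ l, l + 1 < L → φ l 0 = 0) {δ : ℕ → ℝ} {c : ℝ} (hc : 1 ≤ c)
    (hA : ∀ l < L, 0 < ‖A l‖) (hδ : ∀ l < L, ‖A l - B l‖ ≤ δ l)
    (hB : ∀ l < L, ‖B l‖ ≤ c * ‖A l‖) (x : EuclideanSpace ℝ (Fin (n 0))) :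
    ∀ l, l < L → ‖layerOutput A φ x (l + 1) - layerOutput B φ x (l + 1)‖ ≤
      c ^ (l + 1) * (‖A l‖ * (∏ i ∈ Finset.range l, (Lip i : ℝ) * ‖A i‖)) * ‖x‖ *
        ∑ i ∈ Finset.range (l + 1), δ i / ‖A i‖
  | 0, h0 => by
    have ha := hA 0 h0
    have h1 : layerOutput A φ x 1 - layerOutput B φ x 1 =
        Matrix.toEuclideanLin (A 0 - B 0) x := by
      simp [layerOutput, map_sub]
    have hδ0 : 0 ≤ δ 0 := (norm_nonneg _).trans (hδ 0 h0)
    change ‖layerOutput A φ x 1 - layerOutput B φ x 1‖ ≤ _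
    rw [h1]
    calc _ ≤ ‖A 0 - B 0‖ * ‖x‖ := norm_toEuclideanLin_le _ _
      _ ≤ δ 0 * ‖x‖ := by gcongr; exact hδ 0 h0
      _ ≤ c * (δ 0 * ‖x‖) := le_mul_of_one_le_left (by positivity) hc
      _ = _ := by
        simp only [zero_add, Finset.range_zero, Finset.prod_empty, Finset.sum_range_one]
        field_simp
  | l + 1, hl => by
    have ih := norm_layerOutput_sub_le hφ hφ0 hc hA hδ hB x l (by omega)
    have hx := norm_layerOutput_le (A := A) hφ hφ0 x (l + 1) hl
    have hx0 := norm_layerOutput_le (A := A) hφ hφ0 x l (by omega)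
    have ha := hA (l + 1) hl
    have hδl : 0 ≤ δ (l + 1) := (norm_nonneg _).trans (hδ (l + 1) hl)
    set u := layerOutput A φ x (l + 1)
    set w := layerOutput B φ x (l + 1)
    set Q := ‖A l‖ * (∏ i ∈ Finset.range l, (Lip i : ℝ) * ‖A i‖) with hQ
    have hQ0 : 0 ≤ Q := mul_nonneg (norm_nonneg _) (prod_lip_mul_norm_nonneg A Lip l)
    set S := ∑ i ∈ Finset.range (l + 1), δ i / ‖A i‖
    have h1 : ‖φ l u‖ ≤ Lip l * ‖u‖ := by
      have := (hφ l hl).dist_le_mul u 0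
      rwa [hφ0 l hl, dist_zero_right, dist_zero_right] at this
    have h2 : ‖φ l u - φ l w‖ ≤ Lip l * ‖u - w‖ := (hφ l hl).norm_sub_le u w
    -- The weight error acts on the exact signal, whose size is known; the inherited error passes
    -- through the perturbed weights, which costs the factor `c`.
    have h3 : layerOutput A φ x (l + 1 + 1) - layerOutput B φ x (l + 1 + 1) =
        Matrix.toEuclideanLin (A (l + 1) - B (l + 1)) (φ l u) +
          Matrix.toEuclideanLin (B (l + 1)) (φ l u - φ l w) := by
      simp only [layerOutput, map_sub, LinearMap.sub_apply]
      abel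
    rw [h3, Finset.sum_range_succ, Finset.prod_range_succ]
    have hcl : (1 : ℝ) ≤ c ^ (l + 1 + 1) := one_le_pow₀ hc
    calc _ ≤ ‖A (l + 1) - B (l + 1)‖ * ‖φ l u‖ + ‖B (l + 1)‖ * ‖φ l u - φ l w‖ :=
          (norm_add_le _ _).trans
            (add_le_add (norm_toEuclideanLin_le _ _) (norm_toEuclideanLin_le _ _))
      _ ≤ δ (l + 1) * (Lip l * (Q * ‖x‖)) +
          c * ‖A (l + 1)‖ * (Lip l * (c ^ (l + 1) * Q * ‖x‖ * S)) := by
        gcongr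
        · exact hδ _ hl
        · exact h1.trans (by gcongr)
        · exact hB _ hl
        · exact h2.trans (by gcongr)
      _ ≤ c ^ (l + 1 + 1) * (δ (l + 1) * (Lip l * (Q * ‖x‖))) +
          c * ‖A (l + 1)‖ * (Lip l * (c ^ (l + 1) * Q * ‖x‖ * S)) := by
        gcongr ?_ + _
        exact le_mul_of_one_le_left (by positivity) hcl
      _ = _ := by
        rw [hQ]
        field_simp
        ring

/-- Perturbation bound for a network whose weights are perturbed by at most a fraction `1 / L` of
their operator norms. -/
lemma norm_output_sub_le (hφ : ∀ l, l + 1 < L → LipschitzWith (Lip l) (φ l))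
    (hφ0 : ∀ l, l + 1 < L → φ l 0 = 0) (hLip : ∀ l, l + 1 = L → Lip l = 1) {δ : ℕ → ℝ}
    (hA : ∀ l < L, 0 < ‖A l‖) (hδ : ∀ l < L, ‖A l - B l‖ ≤ δ l)
    (hδL : ∀ l < L, δ l ≤ 1 / (L : ℝ) * ‖A l‖) (x : EuclideanSpace ℝ (Fin (n 0))) :
    ‖layerOutput A φ x L - layerOutput B φ x L‖ ≤
      Real.exp 1 * ‖x‖ * (∏ l ∈ Finset.range L, (Lip l : ℝ) * ‖A l‖) *
        ∑ l ∈ Finset.range L, δ l / ‖A l‖ := by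
  rcases Nat.eq_zero_or_pos L with rfl | hL
  · simp [layerOutput]
  obtain ⟨l, rfl⟩ : ∃ l, L = l + 1 := ⟨L - 1, by omega⟩
  have hδ0 : ∀ i < l + 1, 0 ≤ δ i := fun i hi => (norm_nonneg _).trans (hδ i hi)
  have hB : ∀ i < l + 1, ‖B i‖ ≤ (1 + 1 / ((l + 1 : ℕ) : ℝ)) * ‖A i‖ := by
    intro i hi
    have h1 : ‖B i‖ ≤ ‖A i‖ + ‖A i - B i‖ := by
      have := norm_sub_le (A i) (A i - B i)
      simpa using this
    have := hδ i hi
    have := hδL i hi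
    linarith
  have hc : (1 : ℝ) ≤ 1 + 1 / ((l + 1 : ℕ) : ℝ) := by
    have : (0 : ℝ) ≤ 1 / ((l + 1 : ℕ) : ℝ) := by positivity
    linarith
  have hexp : (1 + 1 / ((l + 1 : ℕ) : ℝ)) ^ (l + 1) ≤ Real.exp 1 := by
    have h1 := Real.add_one_le_exp (1 / ((l + 1 : ℕ) : ℝ))
    calc (1 + 1 / ((l + 1 : ℕ) : ℝ)) ^ (l + 1)
        ≤ Real.exp (1 / ((l + 1 : ℕ) : ℝ)) ^ (l + 1) := by gcongr; linarith
      _ = Real.exp 1 := by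
        rw [← Real.exp_nat_mul]
        congr 1
        field_simp
  refine (norm_layerOutput_sub_le hφ hφ0 hc hA hδ hB x l (Nat.lt_succ_self l)).trans ?_
  have hS : 0 ≤ ∑ i ∈ Finset.range (l + 1), δ i / ‖A i‖ :=
    Finset.sum_nonneg fun i hi => div_nonneg (hδ0 i (Finset.mem_range.1 hi)) (norm_nonneg _)
  have hP := mul_nonneg (norm_nonneg (A l)) (prod_lip_mul_norm_nonneg A Lip l)
  -- The convention `Lip l = 1` for the last layer lets the product run over all layers.
  rw [Finset.prod_range_succ, hLip l rfl]
  calc _ ≤ Real.exp 1 * (‖A l‖ * (∏ i ∈ Finset.range l, (Lip i : ℝ) * ‖A i‖)) * ‖x‖ *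
        ∑ i ∈ Finset.range (l + 1), δ i / ‖A i‖ := by gcongr
    _ = _ := by push_cast; ring

end Network

/-! ### Exponential moments of Gaussian quadratic forms -/

section GaussianChaos

lemma lintegral_pi_prod {ι E : Type*} [Fintype ι] [MeasurableSpace E] (μ : Measure E)
    [IsProbabilityMeasure μ] {f : ι → E → ENNReal} (hf : ∀ i, Measurable (f i)) :
    ∫⁻ x, ∏ i, f i (x i) ∂(Measure.pi fun _ : ι => μ) = ∏ i, ∫⁻ t, f i t ∂μ := by
  have hind : iIndepFun (fun i (x : ι → E) => f i (x i)) (Measure.pi fun _ : ι => μ) :=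
    iIndepFun_pi fun i => (hf i).aemeasurable
  rw [lintegral_prod_eq_prod_lintegral_of_indepFun Finset.univ _ hind
    fun i => (hf i).comp (measurable_pi_apply i)]
  refine Finset.prod_congr rfl fun i _ => ?_
  exact (measurePreserving_eval (fun _ : ι => μ) i).lintegral_comp (hf i)

lemma lintegral_exp_mul_gaussian (c : ℝ) :
    ∫⁻ h, ENNReal.ofReal (Real.exp (c * h)) ∂gaussianReal 0 1 =
      ENNReal.ofReal (Real.exp (c ^ 2 / 2)) := by
  rw [← ofReal_integral_eq_lintegral_ofReal (integrable_exp_mul_gaussianReal c)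
    (ae_of_all _ fun h => (Real.exp_pos _).le)]
  have h := mgf_id_gaussianReal (μ := 0) (v := 1)
  have h1 := congrFun h c
  simp only [mgf, id] at h1
  rw [h1]
  simp

lemma exp_mul_gaussianPDFReal (c h : ℝ) :
    gaussianPDFReal 0 1 h * Real.exp (c * h ^ 2) =
      (√(2 * Real.pi))⁻¹ * Real.exp (-(1 / 2 - c) * h ^ 2) := by
  simp only [gaussianPDFReal, NNReal.coe_one, mul_one, sub_zero]
  rw [mul_assoc, ← Real.exp_add]
  congr 2
  ring

/-- The exact value is `(1 - 2c)^(-1/2)`, and `(1 + 4c)(1 - 2c) ≥ 1` holds exactly for `0 ≤ c ≤ 1 /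
4`. -/
lemma lintegral_exp_mul_sq_gaussian_le {c : ℝ} (hc0 : 0 ≤ c) (hc : c ≤ 1 / 4) :
    ∫⁻ h, ENNReal.ofReal (Real.exp (c * h ^ 2)) ∂gaussianReal 0 1 ≤
      ENNReal.ofReal (Real.exp (2 * c)) := by
  have hb : 0 < 1 / 2 - c := by linarith
  rw [gaussianReal_of_var_ne_zero _ one_ne_zero,
    lintegral_withDensity_eq_lintegral_mul _ (measurable_gaussianPDF 0 1) (by fun_prop)]
  have h1 : ∀ h, (gaussianPDF 0 1 * fun h => ENNReal.ofReal (Real.exp (c * h ^ 2))) h =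
      ENNReal.ofReal ((√(2 * Real.pi))⁻¹ * Real.exp (-(1 / 2 - c) * h ^ 2)) := fun h => by
    rw [Pi.mul_apply, gaussianPDF, ← ENNReal.ofReal_mul (gaussianPDFReal_nonneg _ _ _),
      exp_mul_gaussianPDFReal]
  simp only [h1]
  rw [← ofReal_integral_eq_lintegral_ofReal ((integrable_exp_neg_mul_sq hb).const_mul _)
    (ae_of_all _ fun h => by positivity), integral_const_mul, integral_gaussian]
  refine ENNReal.ofReal_le_ofReal ?_
  rw [← Real.sqrt_inv, ← Real.sqrt_mul (by positivity)]
  refine Real.sqrt_le_iff.2 ⟨(Real.exp_pos _).le, ?_⟩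
  rw [← Real.exp_nat_mul]
  have h2 : (2 * Real.pi)⁻¹ * (Real.pi / (1 / 2 - c)) = 1 / (1 - 2 * c) := by
    have := Real.pi_pos
    field_simp
  rw [h2, div_le_iff₀ (by linarith)]
  have h3 := Real.add_one_le_exp (((2 : ℕ) : ℝ) * (2 * c))
  push_cast at h3 ⊢
  nlinarith [mul_le_mul_of_nonneg_right h3 (by linarith : 0 ≤ 1 - 2 * c)]

variable {m k : ℕ}

/-- Exponential moments of `∑ i (∑ j w i j g i j)²` for independent standard Gaussians `g i j`. -/
lemma lintegral_exp_sum_sq_gaussian_le (w : Fin m → Fin k → ℝ) {c : ℝ} (hc : 0 ≤ c)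
    (hw : ∀ i, c * ∑ j, w i j ^ 2 ≤ 1 / 4) :
    ∫⁻ g, ENNReal.ofReal (Real.exp (c * ∑ i, (∑ j, w i j * g (i, j)) ^ 2))
        ∂(Measure.pi fun _ : Fin m × Fin k => gaussianReal 0 1) ≤
      ENNReal.ofReal (Real.exp (2 * c * ∑ i, ∑ j, w i j ^ 2)) := by
  set γ := Measure.pi fun _ : Fin m × Fin k => gaussianReal 0 1
  set η := Measure.pi fun _ : Fin m => gaussianReal 0 1
  have hsq : √(2 * c) ^ 2 = 2 * c := Real.sq_sqrt (by positivity)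
  -- Linearization: `exp (c x²)` is the mean of `exp (√(2c) x h)` over an auxiliary standard
  -- Gaussian `h`, one for each row.
  have hlin : ∀ g : Fin m × Fin k → ℝ,
      ENNReal.ofReal (Real.exp (c * ∑ i, (∑ j, w i j * g (i, j)) ^ 2)) =
        ∫⁻ h, ∏ p : Fin m × Fin k,
          ENNReal.ofReal (Real.exp (√(2 * c) * w p.1 p.2 * h p.1 * g p)) ∂η := by
    intro g
    have h1 : ∀ h : Fin m → ℝ, (∏ p : Fin m × Fin k,
        ENNReal.ofReal (Real.exp (√(2 * c) * w p.1 p.2 * h p.1 * g p))) =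
        ∏ i, ENNReal.ofReal (Real.exp (√(2 * c) * (∑ j, w i j * g (i, j)) * h i)) := by
      intro h
      rw [← Finset.univ_product_univ, Finset.prod_product]
      refine Finset.prod_congr rfl fun i _ => ?_
      rw [← ENNReal.ofReal_prod_of_nonneg fun _ _ => (Real.exp_pos _).le, ← Real.exp_sum,
        Finset.mul_sum, Finset.sum_mul]
      congr 2
      exact Finset.sum_congr rfl fun j _ => by ring
    simp only [h1]
    rw [lintegral_pi_prod (f := fun i t =>
      ENNReal.ofReal (Real.exp (√(2 * c) * (∑ j, w i j * g (i, j)) * t))) _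
      fun i => by fun_prop]
    simp only [lintegral_exp_mul_gaussian]
    rw [← ENNReal.ofReal_prod_of_nonneg fun _ _ => (Real.exp_pos _).le, ← Real.exp_sum,
      Finset.mul_sum]
    congr 2
    refine Finset.sum_congr rfl fun i _ => ?_
    rw [mul_pow, hsq]
    ring
  simp only [hlin]
  rw [lintegral_lintegral_swap (by fun_prop)]
  -- After swapping the integrals the exponent is linear in `g`, so the integral over `g` is
  -- explicit and leaves one square `h i ^ 2` per row.
  have hint : ∀ h : Fin m → ℝ, ∫⁻ g, ∏ p : Fin m × Fin k,
      ENNReal.ofReal (Real.exp (√(2 * c) * w p.1 p.2 * h p.1 * g p)) ∂γ =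
      ∏ i, ENNReal.ofReal (Real.exp ((c * ∑ j, w i j ^ 2) * h i ^ 2)) := by
    intro h
    rw [lintegral_pi_prod (f := fun (p : Fin m × Fin k) t =>
      ENNReal.ofReal (Real.exp (√(2 * c) * w p.1 p.2 * h p.1 * t))) _ fun i => by fun_prop]
    simp only [lintegral_exp_mul_gaussian]
    rw [← Finset.univ_product_univ, Finset.prod_product]
    refine Finset.prod_congr rfl fun i _ => ?_
    rw [← ENNReal.ofReal_prod_of_nonneg fun _ _ => (Real.exp_pos _).le, ← Real.exp_sum,
      Finset.mul_sum, Finset.sum_mul]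
    congr 2
    refine Finset.sum_congr rfl fun j _ => ?_
    rw [mul_pow, mul_pow, hsq]
    ring
  simp only [hint]
  rw [lintegral_pi_prod (f := fun i t =>
    ENNReal.ofReal (Real.exp ((c * ∑ j, w i j ^ 2) * t ^ 2))) _ fun i => by fun_prop]
  refine (Finset.prod_le_prod' fun i _ =>
    lintegral_exp_mul_sq_gaussian_le (by positivity) (hw i)).trans ?_
  rw [← ENNReal.ofReal_prod_of_nonneg fun _ _ => (Real.exp_pos _).le, ← Real.exp_sum,
    ← Finset.mul_sum, ← Finset.mul_sum, mul_assoc]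

end GaussianChaos

/-! ### Lattice nets: domination and cardinality -/

section LatticeNet

/-- A convex function on a box is dominated by one of its values at the vertices. -/
lemma exists_vertex_ge {k : ℕ} {f : (Fin k → ℝ) → ℝ} (hf : ConvexOn ℝ Set.univ f)
    {v a b : Fin k → ℝ} (hv : ∀ j, v j ∈ Set.Icc (a j) (b j)) :
    ∃ w : Fin k → ℝ, (∀ j, w j = a j ∨ w j = b j) ∧ f v ≤ f w := by
  have h : v ∈ convexHull ℝ (Set.univ.pi fun j => ({a j, b j} : Set ℝ)) := by
    rw [convexHull_pi]
    intro j _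
    change v j ∈ convexHull ℝ {a j, b j}
    rw [convexHull_pair, segment_eq_Icc ((hv j).1.trans (hv j).2)]
    exact hv j
  obtain ⟨w, hw, hfw⟩ := hf.exists_ge_of_mem_convexHull (Set.subset_univ _) h
  exact ⟨w, fun j => by simpa using hw j (Set.mem_univ j), hfw⟩

variable {m k : ℕ}

lemma convexOn_sum_sq (A : Matrix (Fin m) (Fin k) ℝ) :
    ConvexOn ℝ Set.univ fun v : Fin k → ℝ => ∑ i, (∑ j, A i j * v j) ^ 2 := by
  have hi : ∀ i, ConvexOn ℝ Set.univ fun v : Fin k → ℝ => (∑ j, A i j * v j) ^ 2 := by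
    intro i
    refine ⟨convex_univ, fun x _ y _ a b ha hb hab => ?_⟩
    have h1 : ∑ j, A i j * (a • x + b • y) j =
        a * (∑ j, A i j * x j) + b * ∑ j, A i j * y j := by
      rw [Finset.mul_sum, Finset.mul_sum, ← Finset.sum_add_distrib]
      refine Finset.sum_congr rfl fun j _ => ?_
      simp only [Pi.add_apply, Pi.smul_apply, smul_eq_mul]
      ring
    simp only [h1, smul_eq_mul]
    have hb' : b = 1 - a := by linarith
    subst hb'
    nlinarith [mul_nonneg (mul_nonneg ha hb)
      (sq_nonneg ((∑ j, A i j * x j) - ∑ j, A i j * y j))]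
  refine ⟨convex_univ, fun x hx y hy a b ha hb hab => ?_⟩
  simp only [Finset.smul_sum, ← Finset.sum_add_distrib]
  exact Finset.sum_le_sum fun i _ => (hi i).2 hx hy ha hb hab

/-- Integer points of the ball of radius `2 √s` with coordinates at most `2 √(s β)`. -/
noncomputable def latticeNet (k : ℕ) (s β : ℝ) : Finset (Fin k → ℤ) :=
  {z ∈ Fintype.piFinset fun _ : Fin k => Finset.Icc (-⌈4 * s⌉) ⌈4 * s⌉ |
    ∑ j, (z j : ℝ) ^ 2 ≤ 4 * s ∧ ∀ j, (z j : ℝ) ^ 2 ≤ 4 * s * β}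

lemma abs_le_sq_int (z : ℤ) : |(z : ℝ)| ≤ (z : ℝ) ^ 2 := by
  have h : |z| ≤ z ^ 2 := by
    rw [← sq_abs]
    rcases (abs_nonneg z).eq_or_lt with h | h
    · rw [← h]; norm_num
    · nlinarith
  exact_mod_cast h

lemma mem_latticeNet {s β : ℝ} {z : Fin k → ℤ} (h1 : ∑ j, (z j : ℝ) ^ 2 ≤ 4 * s)
    (h2 : ∀ j, (z j : ℝ) ^ 2 ≤ 4 * s * β) : z ∈ latticeNet k s β := by
  refine Finset.mem_filter.2 ⟨Fintype.mem_piFinset.2 fun j => ?_, h1, h2⟩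
  have h3 : |(z j : ℝ)| ≤ 4 * s :=
    (abs_le_sq_int _).trans ((Finset.single_le_sum (f := fun j => (z j : ℝ) ^ 2)
      (fun _ _ => sq_nonneg _) (Finset.mem_univ j)).trans h1)
  have h4 : |z j| ≤ ⌈4 * s⌉ := by
    have : |(z j : ℝ)| ≤ (⌈4 * s⌉ : ℝ) := h3.trans (Int.le_ceil _)
    exact_mod_cast this
  rw [Finset.mem_Icc]
  exact abs_le.1 h4

/-- Round `√s v` coordinatewise to the best vertex of its integer cell. Rounding gives `z² ≤ 2 s v²
+ 2`. The additive 2 is harmless in the sum if `s = k`, and otherwise because each coordinate is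
zero (and stays zero) or satisfies `s v² ≥ 1`. -/
lemma exists_latticeNet_ge (A : Matrix (Fin m) (Fin k) ℝ) {s β : ℝ} (hs : 0 < s)
    (hsβ : 1 ≤ s * β) {v : Fin k → ℝ} (hv : ∑ j, v j ^ 2 ≤ 1) (hvβ : ∀ j, v j ^ 2 ≤ β)
    (h : s = k ∨ ∀ j, v j = 0 ∨ 1 ≤ s * v j ^ 2) :
    ∃ z ∈ latticeNet k s β,
      ∑ i, (∑ j, A i j * v j) ^ 2 ≤ s⁻¹ * ∑ i, (∑ j, A i j * (z j : ℝ)) ^ 2 := by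
  have hr : 0 < √s := Real.sqrt_pos.2 hs
  have hr2 : √s ^ 2 = s := Real.sq_sqrt hs.le
  obtain ⟨w, hw, hfw⟩ := exists_vertex_ge (convexOn_sum_sq A) (v := fun j => √s * v j)
    (a := fun j => (⌊√s * v j⌋ : ℝ)) (b := fun j => (⌈√s * v j⌉ : ℝ))
    fun j => ⟨Int.floor_le _, Int.le_ceil _⟩
  have hex : ∀ j, ∃ z : ℤ, w j = z ∧ (z = ⌊√s * v j⌋ ∨ z = ⌈√s * v j⌉) := fun j => by
    rcases hw j with h | h
    · exact ⟨_, h, Or.inl rfl⟩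
    · exact ⟨_, h, Or.inr rfl⟩
  choose z hz hzr using hex
  have habs : ∀ j, |(z j : ℝ)| ≤ |√s * v j| + 1 := by
    intro j
    have h1 := Int.floor_le (√s * v j)
    have h2 := Int.lt_floor_add_one (√s * v j)
    have h3 := Int.le_ceil (√s * v j)
    have h4 := Int.ceil_lt_add_one (√s * v j)
    have h5 : |(z j : ℝ) - √s * v j| ≤ 1 := by
      rw [abs_le]
      rcases hzr j with h | h <;> rw [h] <;> constructor <;> linarith
    have h6 := abs_add_le ((z j : ℝ) - √s * v j) (√s * v j)
    rw [sub_add_cancel] at h6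
    linarith
  have hsq : ∀ j, (√s * v j) ^ 2 = s * v j ^ 2 := fun j => by rw [mul_pow, hr2]
  have hz1 : ∀ j, (z j : ℝ) ^ 2 ≤ 2 * (s * v j ^ 2) + 2 := by
    intro j
    rw [← hsq, ← sq_abs (z j : ℝ), ← sq_abs (√s * v j)]
    have := habs j
    nlinarith [abs_nonneg (z j : ℝ), sq_nonneg (|√s * v j| - 1)]
  have hz2 : ∀ j, (v j = 0 ∨ 1 ≤ s * v j ^ 2) → (z j : ℝ) ^ 2 ≤ 4 * (s * v j ^ 2) := by
    rintro j (h | h)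
    · have : z j = 0 := by
        rcases hzr j with h' | h' <;> simpa [h] using h'
      rw [this, h]; simp
    · linarith [hz1 j]
  refine ⟨z, mem_latticeNet ?_ ?_, ?_⟩
  · rcases h with h | h
    · calc ∑ j, (z j : ℝ) ^ 2 ≤ ∑ j, (2 * (s * v j ^ 2) + 2) :=
            Finset.sum_le_sum fun j _ => hz1 j
        _ = 2 * s * ∑ j, v j ^ 2 + 2 * s := by
          rw [Finset.sum_add_distrib, Finset.mul_sum, h]
          simp [mul_comm, mul_assoc, mul_left_comm]
        _ ≤ 4 * s := by nlinarith
    · calc ∑ j, (z j : ℝ) ^ 2 ≤ ∑ j, 4 * (s * v j ^ 2) :=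
            Finset.sum_le_sum fun j _ => hz2 j (h j)
        _ = 4 * s * ∑ j, v j ^ 2 := by
          rw [Finset.mul_sum]; exact Finset.sum_congr rfl fun j _ => by ring
        _ ≤ 4 * s := by nlinarith
  · intro j
    have h1 : s * v j ^ 2 ≤ s * β := by gcongr; exact hvβ j
    linarith [hz1 j]
  · have h1 : ∀ i, ∑ j, A i j * (√s * v j) = √s * ∑ j, A i j * v j := fun i => by
      rw [Finset.mul_sum]; exact Finset.sum_congr rfl fun j _ => by ring
    simp only [h1, mul_pow, hr2, ← Finset.mul_sum, hz] at hfw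
    rw [inv_mul_eq_div, le_div_iff₀ hs, mul_comm]
    exact hfw

lemma sum_Icc_exp_neg_le {θ : ℝ} (hθ : 1 ≤ θ) (B : ℕ) :
    ∑ n ∈ Finset.Icc (-(B : ℤ)) B, Real.exp (-θ * (n : ℝ) ^ 2) ≤ 1 + 4 * Real.exp (-θ) := by
  have he : Real.exp (-1) ≤ 1 / 2 := by
    rw [Real.exp_neg, one_div]
    exact inv_anti₀ (by norm_num) (by have := Real.add_one_le_exp (1 : ℝ); linarith)
  -- The slack `(1 / 2) ^ B` makes the induction close: the two new terms are at most `2 exp (-θ) (1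
  -- / 2) ^ B`, exactly what the right side gains.
  have key : ∀ B : ℕ, ∑ n ∈ Finset.Icc (-(B : ℤ)) B, Real.exp (-θ * (n : ℝ) ^ 2) ≤
      1 + 4 * Real.exp (-θ) * (1 - (1 / 2) ^ B) := by
    intro B
    induction B with
    | zero => simp
    | succ B ih =>
      have hset : Finset.Icc (-((B + 1 : ℕ) : ℤ)) ((B + 1 : ℕ) : ℤ) =
          insert (-((B : ℤ) + 1)) (insert ((B : ℤ) + 1) (Finset.Icc (-(B : ℤ)) B)) := by
        ext x
        simp only [Finset.mem_Icc, Finset.mem_insert]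
        push_cast
        omega
      rw [hset, Finset.sum_insert (by simp only [Finset.mem_insert, Finset.mem_Icc]; omega),
        Finset.sum_insert (by simp only [Finset.mem_Icc]; omega)]
      have hterm : Real.exp (-θ * ((B : ℝ) + 1) ^ 2) ≤ Real.exp (-θ) * (1 / 2) ^ B := by
        calc Real.exp (-θ * ((B : ℝ) + 1) ^ 2) ≤ Real.exp (-θ + B * (-1)) := by
              refine Real.exp_le_exp.2 ?_
              have : (0 : ℝ) ≤ B := Nat.cast_nonneg B
              nlinarith [mul_nonneg this this]
          _ = Real.exp (-θ) * Real.exp (-1) ^ B := by rw [Real.exp_add, Real.exp_nat_mul]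
          _ ≤ _ := by gcongr
      push_cast
      have e1 : (-1 + -(B : ℝ)) ^ 2 = ((B : ℝ) + 1) ^ 2 := by ring
      rw [neg_add_rev, e1, pow_succ (1 / 2 : ℝ) B]
      nlinarith
  refine (key B).trans ?_
  have : (0 : ℝ) ≤ (1 / 2) ^ B := by positivity
  nlinarith [Real.exp_pos (-θ)]

/-- Each net point has weight `exp (θ (4 s - ∑ z²)) ≥ 1`. Summed over the whole box the weight
factorizes into one-dimensional theta sums, each at most `exp (4 exp (-θ))`; the choice of `θ` gives
`k exp (-θ) ≤ s`. -/
lemma card_latticeNet_le {s β : ℝ} (hs : 0 < s) (hk : s ≤ k) :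
    ((latticeNet k s β).card : ℝ) ≤ Real.exp (8 * s * (1 + Real.log (k / s))) := by
  set θ := 1 + Real.log (k / s) with hθ
  have hk0 : (0 : ℝ) < k := hs.trans_le hk
  have hθ1 : 1 ≤ θ := by
    have : 0 ≤ Real.log (k / s) := Real.log_nonneg (by rwa [le_div_iff₀ hs, one_mul])
    linarith
  have hke : k * Real.exp (-θ) ≤ s := by
    rw [hθ, neg_add, Real.exp_add, Real.exp_neg (Real.log _), Real.exp_log (by positivity),
      inv_div]
    have h1 : Real.exp (-1) ≤ 1 := Real.exp_le_one_iff.2 (by norm_num)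
    calc k * (Real.exp (-1) * (s / k)) = Real.exp (-1) * s := by field_simp
      _ ≤ 1 * s := by gcongr
      _ = s := one_mul s
  have hB : ⌈4 * s⌉ = ((⌈4 * s⌉.toNat : ℕ) : ℤ) :=
    (Int.toNat_of_nonneg (Int.ceil_nonneg (by positivity))).symm
  calc ((latticeNet k s β).card : ℝ) = ∑ z ∈ latticeNet k s β, (1 : ℝ) := by simp
    _ ≤ ∑ z ∈ latticeNet k s β, Real.exp (4 * s * θ) * ∏ j, Real.exp (-θ * (z j : ℝ) ^ 2) := by
      refine Finset.sum_le_sum fun z hz => ?_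
      rw [← Real.exp_sum, ← Real.exp_add, ← Finset.mul_sum]
      refine Real.one_le_exp ?_
      have := (Finset.mem_filter.1 hz).2.1
      nlinarith
    _ ≤ ∑ z ∈ Fintype.piFinset fun _ : Fin k => Finset.Icc (-⌈4 * s⌉) ⌈4 * s⌉,
        Real.exp (4 * s * θ) * ∏ j, Real.exp (-θ * (z j : ℝ) ^ 2) :=
      Finset.sum_le_sum_of_subset_of_nonneg (Finset.filter_subset _ _)
        fun _ _ _ => by positivity
    _ = Real.exp (4 * s * θ) *
        ∏ _j : Fin k, ∑ n ∈ Finset.Icc (-⌈4 * s⌉) ⌈4 * s⌉, Real.exp (-θ * (n : ℝ) ^ 2) := by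
      rw [← Finset.mul_sum, ← Finset.sum_prod_piFinset]
    _ ≤ Real.exp (4 * s * θ) * ∏ _j : Fin k, Real.exp (4 * Real.exp (-θ)) := by
      refine mul_le_mul_of_nonneg_left (Finset.prod_le_prod
        (fun _ _ => Finset.sum_nonneg fun _ _ => (Real.exp_pos _).le) fun j _ => ?_)
        (Real.exp_pos _).le
      rw [hB]
      refine (sum_Icc_exp_neg_le hθ1 _).trans ?_
      rw [add_comm]
      exact Real.add_one_le_exp _
    _ = Real.exp (4 * s * θ + 4 * (k * Real.exp (-θ))) := by
      rw [Finset.prod_const, Finset.card_univ, Fintype.card_fin, ← Real.exp_nat_mul,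
        ← Real.exp_add]
      congr 1
      ring
    _ ≤ Real.exp (8 * s * θ) := Real.exp_le_exp.2 (by nlinarith)

end LatticeNet

/-! ### Gaussian matrices with a fixed mask: one scale and the sum over scales -/

section MaskedGaussian

variable {m k : ℕ}

/-- Exponential sum controlling `s⁻¹ ‖A z‖²` over a finite set `Z` of integer vectors. -/
noncomputable def netSum (Z : Finset (Fin k → ℤ)) (s C σ H : ℝ) (A : Matrix (Fin m) (Fin k) ℝ) :
    ℝ :=
  ∑ z ∈ Z, Real.exp ((4 * σ)⁻¹ * (s⁻¹ * ∑ i, (∑ j, A i j * (z j : ℝ)) ^ 2 - 8 * C) - H)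

lemma netSum_nonneg (Z : Finset (Fin k → ℤ)) (s C σ H : ℝ) (A : Matrix (Fin m) (Fin k) ℝ) :
    0 ≤ netSum Z s C σ H A :=
  Finset.sum_nonneg fun _ _ => (Real.exp_pos _).le

/-- A soft maximum: `x + 1 ≤ exp x` applied to one summand of the exponential sum. -/
lemma le_netSum {Z : Finset (Fin k → ℤ)} {s C σ H : ℝ} (hσ : 0 < σ)
    (A : Matrix (Fin m) (Fin k) ℝ) {z : Fin k → ℤ} (hz : z ∈ Z) :
    s⁻¹ * ∑ i, (∑ j, A i j * (z j : ℝ)) ^ 2 ≤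
      8 * C + 4 * σ * (H + netSum Z s C σ H A) := by
  set y := s⁻¹ * ∑ i, (∑ j, A i j * (z j : ℝ)) ^ 2 with hy
  have h1 : Real.exp ((4 * σ)⁻¹ * (y - 8 * C) - H) ≤ netSum Z s C σ H A :=
    Finset.single_le_sum
      (f := fun z : Fin k → ℤ => Real.exp ((4 * σ)⁻¹ *
        (s⁻¹ * ∑ i, (∑ j, A i j * (z j : ℝ)) ^ 2 - 8 * C) - H))
      (fun _ _ => (Real.exp_pos _).le) hz
  have h2 := Real.add_one_le_exp ((4 * σ)⁻¹ * (y - 8 * C) - H)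
  have h3 : (4 * σ)⁻¹ * (y - 8 * C) ≤ H + netSum Z s C σ H A := by linarith
  rw [inv_mul_le_iff₀ (by positivity)] at h3
  linarith

/-- The matrix with entries `g (i, j)` where `b (i, j)` is `true`, and `0` elsewhere. -/
def maskMatrix (b : Fin m × Fin k → Bool) (g : Fin m × Fin k → ℝ) : Matrix (Fin m) (Fin k) ℝ :=
  fun i j => if b (i, j) = true then g (i, j) else 0

/-- The indicator of `true` as a real number. -/
def boolReal (b : Bool) : ℝ := if b = true then 1 else 0

lemma boolReal_nonneg (b : Bool) : 0 ≤ boolReal b := by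
  unfold boolReal; split_ifs <;> norm_num

lemma boolReal_le_one (b : Bool) : boolReal b ≤ 1 := by
  unfold boolReal; split_ifs <;> norm_num

lemma boolReal_sq (b : Bool) : boolReal b ^ 2 = boolReal b := by
  unfold boolReal; split_ifs <;> norm_num

/-- With `c = 1 / (4 σ s)` the row condition for the exponential moment holds. The total variance,
at most `4 s C`, produces the factor `exp (8 C / (4 σ))`, which the shift by `8 C` cancels; the
shift by `H` pays for the union over the net. -/
lemma lintegral_netSum_le {b : Fin m × Fin k → Bool} {Z : Finset (Fin k → ℤ)} {s C σ H : ℝ}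
    (hs : 0 < s) (hσ : 0 < σ) (hC0 : 0 ≤ C) (hC : ∀ j, ∑ i, boolReal (b (i, j)) ≤ C)
    (hZ : ∀ z ∈ Z, ∑ j, (z j : ℝ) ^ 2 ≤ 4 * s)
    (hZσ : ∀ z ∈ Z, ∀ i, ∑ j, boolReal (b (i, j)) * (z j : ℝ) ^ 2 ≤ s * σ)
    (hcard : (Z.card : ℝ) ≤ Real.exp H) :
    ∫⁻ g, ENNReal.ofReal (netSum Z s C σ H (maskMatrix b g))
      ∂(Measure.pi fun _ : Fin m × Fin k => gaussianReal 0 1) ≤ 1 := by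
  have hterm : ∀ z ∈ Z, ∫⁻ g, ENNReal.ofReal (Real.exp ((4 * σ)⁻¹ *
      (s⁻¹ * ∑ i, (∑ j, maskMatrix b g i j * (z j : ℝ)) ^ 2 - 8 * C) - H))
      ∂(Measure.pi fun _ : Fin m × Fin k => gaussianReal 0 1) ≤
      ENNReal.ofReal (Real.exp (-H)) := by
    intro z hz
    set c := (4 * σ)⁻¹ * s⁻¹ with hc
    set w : Fin m → Fin k → ℝ := fun i j => boolReal (b (i, j)) * (z j : ℝ) with hw
    have hc0 : 0 < c := by positivity
    have hw2 : ∀ i, ∑ j, w i j ^ 2 = ∑ j, boolReal (b (i, j)) * (z j : ℝ) ^ 2 := fun i =>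
      Finset.sum_congr rfl fun j _ => by rw [hw]; simp only [mul_pow, boolReal_sq]
    have h1 : ∀ i, c * ∑ j, w i j ^ 2 ≤ 1 / 4 := by
      intro i
      rw [hw2]
      calc c * ∑ j, boolReal (b (i, j)) * (z j : ℝ) ^ 2 ≤ c * (s * σ) := by
            gcongr; exact hZσ z hz i
        _ = 1 / 4 := by rw [hc]; field_simp
    have h2 := lintegral_exp_sum_sq_gaussian_le w hc0.le h1
    have h3 : ∑ i, ∑ j, w i j ^ 2 ≤ 4 * s * C := by
      simp only [hw2]
      rw [Finset.sum_comm]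
      calc ∑ j, ∑ i, boolReal (b (i, j)) * (z j : ℝ) ^ 2 ≤ ∑ j, C * (z j : ℝ) ^ 2 := by
            refine Finset.sum_le_sum fun j _ => ?_
            rw [← Finset.sum_mul]
            gcongr
            exact hC j
        _ = C * ∑ j, (z j : ℝ) ^ 2 := by rw [Finset.mul_sum]
        _ ≤ C * (4 * s) := by gcongr; exact hZ z hz
        _ = 4 * s * C := by ring
    have h4 : ∀ g : Fin m × Fin k → ℝ, ENNReal.ofReal (Real.exp ((4 * σ)⁻¹ *
        (s⁻¹ * ∑ i, (∑ j, maskMatrix b g i j * (z j : ℝ)) ^ 2 - 8 * C) - H)) =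
        ENNReal.ofReal (Real.exp (-((4 * σ)⁻¹ * (8 * C)) - H)) *
          ENNReal.ofReal (Real.exp (c * ∑ i, (∑ j, w i j * g (i, j)) ^ 2)) := by
      intro g
      rw [← ENNReal.ofReal_mul (Real.exp_pos _).le, ← Real.exp_add]
      congr 2
      have h5 : ∀ i, ∑ j, maskMatrix b g i j * (z j : ℝ) = ∑ j, w i j * g (i, j) := fun i =>
        Finset.sum_congr rfl fun j _ => by
          simp only [maskMatrix, hw, boolReal]
          split_ifs <;> ring
      simp only [h5]
      ring
    simp only [h4]
    rw [lintegral_const_mul _ (by fun_prop)]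
    calc _ ≤ ENNReal.ofReal (Real.exp (-((4 * σ)⁻¹ * (8 * C)) - H)) *
          ENNReal.ofReal (Real.exp (2 * c * ∑ i, ∑ j, w i j ^ 2)) := by gcongr
      _ ≤ ENNReal.ofReal (Real.exp (-H)) := by
        rw [← ENNReal.ofReal_mul (Real.exp_pos _).le, ← Real.exp_add]
        refine ENNReal.ofReal_le_ofReal (Real.exp_le_exp.2 ?_)
        have h6 : 2 * c * ∑ i, ∑ j, w i j ^ 2 ≤ 2 * c * (4 * s * C) := by gcongr
        have h7 : 2 * c * (4 * s * C) = (4 * σ)⁻¹ * (8 * C) := by rw [hc]; field_simp; ring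
        linarith
  have hmeas : ∀ z ∈ Z, Measurable fun g : Fin m × Fin k → ℝ =>
      ENNReal.ofReal (Real.exp ((4 * σ)⁻¹ *
        (s⁻¹ * ∑ i, (∑ j, maskMatrix b g i j * (z j : ℝ)) ^ 2 - 8 * C) - H)) := by
    intro z _
    have : ∀ i j, Measurable fun g : Fin m × Fin k → ℝ => maskMatrix b g i j := fun i j => by
      simp only [maskMatrix]
      split_ifs <;> fun_prop
    fun_prop
  simp only [netSum]
  simp_rw [ENNReal.ofReal_sum_of_nonneg fun z _ => (Real.exp_pos _).le]
  rw [lintegral_finsetSum _ hmeas]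
  refine (Finset.sum_le_sum hterm).trans ?_
  rw [Finset.sum_const, nsmul_eq_mul, ← ENNReal.ofReal_natCast,
    ← ENNReal.ofReal_mul (Nat.cast_nonneg _), ← ENNReal.ofReal_one]
  refine ENNReal.ofReal_le_ofReal ?_
  calc (Z.card : ℝ) * Real.exp (-H) ≤ Real.exp H * Real.exp (-H) := by gcongr
    _ = 1 := by rw [← Real.exp_add]; simp

/-- Cauchy–Schwarz over the `N` levels gives the factor `N`; each level is then dominated by a net
point of its own scale. -/
lemma sq_opNorm_le_netSum {N : ℕ} {s β σ H : Fin N → ℝ} {C : ℝ} (hs : ∀ l, 0 < s l)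
    (hsβ : ∀ l, 1 ≤ s l * β l) (hσ : ∀ l, 0 < σ l) (hH : ∀ l, 0 ≤ H l) (hC : 0 ≤ C)
    (hlev : ∀ t : ℝ, 0 ≤ t → t ≤ 1 → ∃ l, t ≤ β l ∧ (s l = k ∨ 1 ≤ s l * t))
    (A : Matrix (Fin m) (Fin k) ℝ) :
    ‖A‖ ^ 2 ≤ N * ∑ l, (8 * C + 4 * σ l *
      (H l + netSum (latticeNet k (s l) (β l)) (s l) C (σ l) (H l) A)) := by
  have hterm0 : ∀ l, 0 ≤ 8 * C + 4 * σ l *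
      (H l + netSum (latticeNet k (s l) (β l)) (s l) C (σ l) (H l) A) := fun l => by
    have := netSum_nonneg (latticeNet k (s l) (β l)) (s l) C (σ l) (H l) A
    have := hσ l
    have := hH l
    positivity
  refine sq_opNorm_le A (mul_nonneg (Nat.cast_nonneg _)
    (Finset.sum_nonneg fun l _ => hterm0 l)) fun v hv => ?_
  have hv1 : ∀ j, v j ^ 2 ≤ 1 := fun j =>
    (Finset.single_le_sum (f := fun j => v j ^ 2) (fun _ _ => sq_nonneg _)
      (Finset.mem_univ j)).trans hv
  choose lev hlevβ hlevs using fun j => hlev (v j ^ 2) (sq_nonneg _) (hv1 j)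
  -- Each coordinate goes to one level, chosen by its size, so the pieces have disjoint supports.
  set u : Fin N → Fin k → ℝ := fun l j => if lev j = l then v j else 0 with hu
  have hdec : ∀ i, ∑ j, A i j * v j = ∑ l, ∑ j, A i j * u l j := by
    intro i
    rw [Finset.sum_comm]
    refine Finset.sum_congr rfl fun j _ => ?_
    simp [hu]
  have husq : ∀ l j, u l j ^ 2 ≤ v j ^ 2 := fun l j => by
    simp only [hu]
    split_ifs
    · exact le_rfl
    · simpa using sq_nonneg (v j)
  have hlevel : ∀ l, ∑ i, (∑ j, A i j * u l j) ^ 2 ≤ 8 * C + 4 * σ l *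
      (H l + netSum (latticeNet k (s l) (β l)) (s l) C (σ l) (H l) A) := by
    intro l
    have hβ0 : 0 ≤ β l := by
      by_contra hneg
      push Not at hneg
      nlinarith [hs l, hsβ l]
    obtain ⟨z, hz, hle⟩ := exists_latticeNet_ge A (hs l) (hsβ l) (v := u l)
      ((Finset.sum_le_sum fun j _ => husq l j).trans hv)
      (fun j => by
        by_cases h : lev j = l
        · simpa [hu, h] using h ▸ hlevβ j
        · simpa [hu, h] using hβ0)
      (by
        by_cases hsk : s l = k
        · exact Or.inl hsk
        · refine Or.inr fun j => ?_
          by_cases h : lev j = l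
          · right
            have h1 := hlevs j
            rw [h] at h1
            simpa [hu, h] using h1.resolve_left hsk
          · left
            simp [hu, h])
    exact hle.trans (le_netSum (hσ l) A hz)
  calc ∑ i, (∑ j, A i j * v j) ^ 2 ≤ ∑ i, (N : ℝ) * ∑ l, (∑ j, A i j * u l j) ^ 2 := by
        refine Finset.sum_le_sum fun i _ => ?_
        rw [hdec]
        simpa using sq_sum_le_card_mul_sum_sq (s := Finset.univ)
          (f := fun l => ∑ j, A i j * u l j)
    _ = N * ∑ l, ∑ i, (∑ j, A i j * u l j) ^ 2 := by
        rw [← Finset.mul_sum, Finset.sum_comm]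
    _ ≤ _ := by
        gcongr with l
        exact hlevel l

/-- The matrix with entries indexed by pairs. -/
def ofPairs (B : Fin m × Fin k → ℝ) : Matrix (Fin m) (Fin k) ℝ :=
  fun i j => B (i, j)

lemma measurable_opNorm_ofPairs_sq :
    Measurable fun B : Fin m × Fin k → ℝ => ‖ofPairs B‖ ^ 2 := by
  have h : Continuous fun B : Fin m × Fin k → ℝ => ofPairs B :=
    continuous_matrix fun i j => continuous_apply (i, j)
  exact (h.norm.pow 2).measurable

end MaskedGaussian

/-! ### Fixed mask with bounded row and column counts: four scales -/

section RandomMask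

variable {m k : ℕ}

lemma measurable_netSum_maskMatrix (b : Fin m × Fin k → Bool) (Z : Finset (Fin k → ℤ))
    (s C σ H : ℝ) :
    Measurable fun g : Fin m × Fin k → ℝ => netSum Z s C σ H (maskMatrix b g) := by
  have : ∀ i j, Measurable fun g : Fin m × Fin k → ℝ => maskMatrix b g i j := fun i j => by
    simp only [maskMatrix]
    split_ifs <;> fun_prop
  unfold netSum
  fun_prop

/-- Second moment of the operator norm of a Gaussian matrix with a fixed sparsity pattern whose
rows and columns have at most `R` and `C` nonzero entries. -/
lemma lintegral_opNorm_sq_maskMatrix_le {b : Fin m × Fin k → Bool} {r C R : ℝ} (hr : 0 < r)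
    (hr1 : r ≤ 1) (hk : 1 ≤ (k : ℝ) * r ^ 10) (hC0 : 0 ≤ C) (hR0 : 0 < R)
    (hC : ∀ j, ∑ i, boolReal (b (i, j)) ≤ C) (hR : ∀ i, ∑ j, boolReal (b (i, j)) ≤ R) :
    ∫⁻ g, ENNReal.ofReal (‖maskMatrix b g‖ ^ 2)
      ∂(Measure.pi fun _ : Fin m × Fin k => gaussianReal 0 1) ≤
      ENNReal.ofReal (10 ^ 4 * (C + R / r ^ 3 + k * r ^ 5)) := by
  have hk0 : (0 : ℝ) < k := by
    by_contra h
    push Not at h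
    nlinarith [pow_pos hr 10]
  have hpow : ∀ a : ℕ, a ≤ 10 → 1 ≤ (k : ℝ) * r ^ a := fun a ha =>
    hk.trans (mul_le_mul_of_nonneg_left (pow_le_pow_of_le_one hr.le hr1 ha) hk0.le)
  -- Level `l` collects the coordinates with square between `1 / s l` and `β l = 1 / s (l + 1)`. The
  -- lowest level needs no lower bound since `s 0 = k`, and the highest has `β = 1`. Four levels
  -- suffice because the last one costs `s 3 / r = k r⁵`, which is `k √p` for `r¹⁰ = p`.
  set s : Fin 4 → ℝ := fun l => k * r ^ (2 * (l : ℕ)) with hs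
  set β : Fin 4 → ℝ := ![(s 1)⁻¹, (s 2)⁻¹, (s 3)⁻¹, 1] with hβ
  -- Row variance relative to `s`: the first three levels use at most `R` coordinates of size `z² ≤
  -- 4 s β`; the last uses only `∑ z² ≤ 4 s`.
  set σ : Fin 4 → ℝ := ![4 * R * (s 1)⁻¹, 4 * R * (s 2)⁻¹, 4 * R * (s 3)⁻¹, 4] with hσ
  set H : Fin 4 → ℝ := fun l => 48 * (s l / r) with hH
  have hs0 : ∀ l, 0 < s l := fun l => by positivity
  have hs1 : ∀ l, 1 ≤ s l := fun l => hpow _ (by omega)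
  have hsk : ∀ l, s l ≤ k := fun l => mul_le_of_le_one_right hk0.le (pow_le_one₀ hr.le hr1)
  have hsr : ∀ l, 1 ≤ s l / r := fun l => by
    rw [le_div_iff₀ hr]
    linarith [hs1 l]
  have hH0 : ∀ l, 0 ≤ H l := fun l => by
    have := hsr l
    simp only [hH]
    linarith
  have hσ0 : ∀ l, 0 < σ l := by
    have h1 := hs0 1
    have h2 := hs0 2
    have h3 := hs0 3
    intro l
    fin_cases l <;> simp only [hσ] <;> norm_num <;> positivity
  have hr2 : 1 ≤ (r ^ 2)⁻¹ := (one_le_inv₀ (by positivity)).2 (pow_le_one₀ hr.le hr1)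
  have hq01 : s 0 * (s 1)⁻¹ = (r ^ 2)⁻¹ := by simp only [hs]; norm_num; field_simp
  have hq12 : s 1 * (s 2)⁻¹ = (r ^ 2)⁻¹ := by simp only [hs]; norm_num; field_simp
  have hq23 : s 2 * (s 3)⁻¹ = (r ^ 2)⁻¹ := by simp only [hs]; norm_num; field_simp
  have hs00 : s 0 = k := by simp [hs]
  have hsβ : ∀ l, 1 ≤ s l * β l := by
    intro l
    fin_cases l
    · exact hr2.trans_eq hq01.symm
    · exact hr2.trans_eq hq12.symm
    · exact hr2.trans_eq hq23.symm
    · simpa [hβ] using hs1 3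
  have hβσ : ∀ l, l = 3 ∨ σ l = 4 * β l * R := by
    intro l
    fin_cases l
    · right; simp [hσ, hβ]; ring
    · right; simp [hσ, hβ]; ring
    · right; simp [hσ, hβ]; ring
    · left; rfl
  have hlev : ∀ t : ℝ, 0 ≤ t → t ≤ 1 → ∃ l, t ≤ β l ∧ (s l = k ∨ 1 ≤ s l * t) := by
    have hstep : ∀ l t, ¬ t ≤ (s l)⁻¹ → 1 ≤ s l * t := fun l t h => by
      push Not at h
      rw [inv_lt_iff_one_lt_mul₀ (hs0 l), mul_comm] at h
      exact h.le
    intro t _ ht1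
    by_cases h1 : t ≤ (s 1)⁻¹
    · exact ⟨0, h1, Or.inl hs00⟩
    by_cases h2 : t ≤ (s 2)⁻¹
    · exact ⟨1, h2, Or.inr (hstep 1 t h1)⟩
    by_cases h3 : t ≤ (s 3)⁻¹
    · exact ⟨2, h3, Or.inr (hstep 2 t h2)⟩
    · exact ⟨3, ht1, Or.inr (hstep 3 t h3)⟩
  have hcard : ∀ l, ((latticeNet k (s l) (β l)).card : ℝ) ≤ Real.exp (H l) := by
    intro l
    refine (card_latticeNet_le (hs0 l) (hsk l)).trans (Real.exp_le_exp.2 ?_)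
    have h1 : (k : ℝ) / s l = (r⁻¹) ^ (2 * (l : ℕ)) := by
      simp only [hs]
      rw [inv_pow]
      field_simp
    have h2 : Real.log r⁻¹ ≤ r⁻¹ - 1 := Real.log_le_sub_one_of_pos (by positivity)
    have h4 : (1 : ℝ) ≤ r⁻¹ := (one_le_inv₀ hr).2 hr1
    have h5 : 0 ≤ Real.log r⁻¹ := Real.log_nonneg h4
    have hl : ((2 * (l : ℕ) : ℕ) : ℝ) ≤ 6 := by
      have : 2 * (l : ℕ) ≤ 6 := by omega
      exact_mod_cast this
    have h3 : 1 + Real.log (k / s l) ≤ 6 / r := by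
      rw [h1, Real.log_pow, div_eq_mul_inv]
      nlinarith
    calc 8 * s l * (1 + Real.log (k / s l)) ≤ 8 * s l * (6 / r) := by
          have := hs0 l
          gcongr
      _ = H l := by simp only [hH]; ring
  have hnet : ∀ l, ∫⁻ g, ENNReal.ofReal
      (netSum (latticeNet k (s l) (β l)) (s l) C (σ l) (H l) (maskMatrix b g))
      ∂(Measure.pi fun _ : Fin m × Fin k => gaussianReal 0 1) ≤ 1 := by
    intro l
    refine lintegral_netSum_le (hs0 l) (hσ0 l) hC0 hC
      (fun z hz => (Finset.mem_filter.1 hz).2.1) (fun z hz i => ?_) (hcard l)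
    rcases hβσ l with h | h
    · have h4 : σ l = 4 := by rw [h]; rfl
      rw [h4, mul_comm (s l)]
      refine le_trans (Finset.sum_le_sum fun j _ => ?_) (Finset.mem_filter.1 hz).2.1
      exact mul_le_of_le_one_left (sq_nonneg _) (boolReal_le_one _)
    · have hβ0 : 0 ≤ β l := by
        by_contra hneg
        push Not at hneg
        nlinarith [hs0 l, hsβ l]
      have hsl := hs0 l
      calc ∑ j, boolReal (b (i, j)) * (z j : ℝ) ^ 2
          ≤ ∑ j, boolReal (b (i, j)) * (4 * s l * β l) :=
            Finset.sum_le_sum fun j _ => mul_le_mul_of_nonneg_left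
              ((Finset.mem_filter.1 hz).2.2 j) (boolReal_nonneg _)
        _ = (∑ j, boolReal (b (i, j))) * (4 * s l * β l) := by rw [Finset.sum_mul]
        _ ≤ R * (4 * s l * β l) := by gcongr; exact hR i
        _ = s l * σ l := by rw [h]; ring
  have hpt : ∀ g, ENNReal.ofReal (‖maskMatrix b g‖ ^ 2) ≤
      ∑ l, (ENNReal.ofReal (4 * (8 * C + 4 * σ l * H l)) + ENNReal.ofReal (4 * (4 * σ l)) *
        ENNReal.ofReal (netSum (latticeNet k (s l) (β l)) (s l) C (σ l) (H l)
          (maskMatrix b g))) := by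
    intro g
    refine (ENNReal.ofReal_le_ofReal
      (sq_opNorm_le_netSum hs0 hsβ hσ0 hH0 hC0 hlev (maskMatrix b g))).trans ?_
    have h0 : ∀ l, 0 ≤ 4 * (8 * C + 4 * σ l * H l) := fun l => by
      have := hσ0 l
      have := hH0 l
      positivity
    have h1 : ∀ l, 0 ≤ 4 * (4 * σ l) * netSum (latticeNet k (s l) (β l)) (s l) C (σ l) (H l)
        (maskMatrix b g) := fun l => by
      have := hσ0 l
      have := netSum_nonneg (latticeNet k (s l) (β l)) (s l) C (σ l) (H l) (maskMatrix b g)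
      positivity
    have h2 : ∀ l, ENNReal.ofReal (4 * (8 * C + 4 * σ l * H l)) + ENNReal.ofReal (4 * (4 * σ l)) *
        ENNReal.ofReal (netSum (latticeNet k (s l) (β l)) (s l) C (σ l) (H l)
          (maskMatrix b g)) = ENNReal.ofReal (4 * (8 * C + 4 * σ l * H l) + 4 * (4 * σ l) *
            netSum (latticeNet k (s l) (β l)) (s l) C (σ l) (H l) (maskMatrix b g)) := fun l => by
      rw [ENNReal.ofReal_add (h0 l) (h1 l),
        ENNReal.ofReal_mul (by have := hσ0 l; positivity : 0 ≤ 4 * (4 * σ l))]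
    simp only [h2]
    rw [← ENNReal.ofReal_sum_of_nonneg fun l _ => add_nonneg (h0 l) (h1 l)]
    refine ENNReal.ofReal_le_ofReal (le_of_eq ?_)
    rw [Finset.mul_sum]
    refine Finset.sum_congr rfl fun l _ => ?_
    push_cast
    ring
  refine (lintegral_mono hpt).trans ?_
  have hmeas : ∀ l, Measurable fun g : Fin m × Fin k → ℝ => ENNReal.ofReal
      (netSum (latticeNet k (s l) (β l)) (s l) C (σ l) (H l) (maskMatrix b g)) :=
    fun l => (measurable_netSum_maskMatrix _ _ _ _ _ _).ennreal_ofReal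
  rw [lintegral_finsetSum _ fun l _ => ((hmeas l).const_mul _).const_add _]
  have hone : ∀ l, ∫⁻ g, (ENNReal.ofReal (4 * (8 * C + 4 * σ l * H l)) +
      ENNReal.ofReal (4 * (4 * σ l)) * ENNReal.ofReal
        (netSum (latticeNet k (s l) (β l)) (s l) C (σ l) (H l) (maskMatrix b g)))
      ∂(Measure.pi fun _ : Fin m × Fin k => gaussianReal 0 1) ≤
      ENNReal.ofReal (4 * (8 * C + 4 * (σ l * (49 * (s l / r))))) := by
    intro l
    have h1 := hσ0 l
    have h2 := hH0 l
    rw [lintegral_add_left measurable_const, lintegral_const_mul _ (hmeas l), lintegral_const,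
      measure_univ, mul_one]
    calc _ ≤ ENNReal.ofReal (4 * (8 * C + 4 * σ l * H l)) + ENNReal.ofReal (4 * (4 * σ l)) * 1 := by
          gcongr
          exact hnet l
      _ = ENNReal.ofReal (4 * (8 * C + 4 * σ l * H l) + 4 * (4 * σ l)) := by
          rw [mul_one, ENNReal.ofReal_add (by positivity) (by positivity)]
      _ ≤ _ := by
          refine ENNReal.ofReal_le_ofReal ?_
          have h3 : σ l * (H l + 1) ≤ σ l * (49 * (s l / r)) := by
            gcongr
            have := hsr l
            simp only [hH]
            linarith
          linarith
  refine (Finset.sum_le_sum fun l _ => hone l).trans ?_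
  rw [← ENNReal.ofReal_sum_of_nonneg fun l _ => by
    have h1 := hσ0 l
    have h2 := hs0 l
    positivity]
  refine ENNReal.ofReal_le_ofReal ?_
  -- Consecutive scales have ratio `r⁻²`, so each of the first three levels costs `R / r³`, of which
  -- `r⁻¹` comes from the logarithm in the net cardinality.
  have e0 : σ 0 * (49 * (s 0 / r)) = 196 * (R / r ^ 3) := by
    have : σ 0 * (49 * (s 0 / r)) = 196 * R / r * (s 0 * (s 1)⁻¹) := by
      simp [hσ]; ring
    rw [this, hq01]; field_simp
  have e1 : σ 1 * (49 * (s 1 / r)) = 196 * (R / r ^ 3) := by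
    have : σ 1 * (49 * (s 1 / r)) = 196 * R / r * (s 1 * (s 2)⁻¹) := by
      simp [hσ]; ring
    rw [this, hq12]; field_simp
  have e2 : σ 2 * (49 * (s 2 / r)) = 196 * (R / r ^ 3) := by
    have : σ 2 * (49 * (s 2 / r)) = 196 * R / r * (s 2 * (s 3)⁻¹) := by
      simp [hσ]; ring
    rw [this, hq23]; field_simp
  have e3 : σ 3 * (49 * (s 3 / r)) = 196 * (k * r ^ 5) := by
    have h1 : σ 3 = 4 := rfl
    have h2 : s 3 = k * r ^ 6 := rfl
    rw [h1, h2]; field_simp; norm_num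
  rw [Fin.sum_univ_four, e0, e1, e2, e3]
  have : 0 ≤ R / r ^ 3 := by positivity
  have : 0 ≤ (k : ℝ) * r ^ 5 := by positivity
  linarith

end RandomMask

/-! ### Random mask: row and column counts, and the regime `k p ≥ 1` -/

section RandomMask

variable {m k : ℕ}

lemma lintegral_bernoulli {E : Type*} [MeasurableSpace E] [MeasurableSingletonClass E]
    (x y : E) (p : unitInterval) (f : E → ENNReal) :
    ∫⁻ b, f b ∂bernoulliMeasure x y p =
      ENNReal.ofReal p * f x + ENNReal.ofReal (1 - p) * f y := by
  have h1 : ((unitInterval.toNNReal p : ℝ≥0) : ENNReal) = ENNReal.ofReal p := by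
    rw [ENNReal.ofReal, Real.toNNReal_of_nonneg p.2.1]; rfl
  have h2 : ((unitInterval.toNNReal (unitInterval.symm p) : ℝ≥0) : ENNReal) =
      ENNReal.ofReal (1 - p) := by
    rw [ENNReal.ofReal, Real.toNNReal_of_nonneg (unitInterval.one_minus_nonneg p)]; rfl
  rw [bernoulliMeasure_def, lintegral_add_measure, lintegral_smul_measure,
    lintegral_smul_measure, lintegral_dirac, lintegral_dirac, ENNReal.smul_def, ENNReal.smul_def,
    h1, h2, smul_eq_mul, smul_eq_mul]

/-- The mean is `1 + p (e - 1) ≤ 1 + 2 p ≤ exp (2 p)`. -/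
lemma lintegral_exp_boolReal_le (p : unitInterval) :
    ∫⁻ b, ENNReal.ofReal (Real.exp (boolReal b)) ∂bernoulliMeasure true false p ≤
      ENNReal.ofReal (Real.exp (2 * p)) := by
  have hp0 := p.2.1
  have hp1 := p.2.2
  rw [lintegral_bernoulli, ← ENNReal.ofReal_mul hp0, ← ENNReal.ofReal_mul (by linarith),
    ← ENNReal.ofReal_add (by positivity) (mul_nonneg (by linarith) (Real.exp_pos _).le)]
  refine ENNReal.ofReal_le_ofReal ?_
  simp only [boolReal, if_true, Bool.false_eq_true, if_false, Real.exp_zero, mul_one]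
  have h1 := Real.exp_one_lt_d9
  have h2 := Real.add_one_le_exp (2 * (p : ℝ))
  nlinarith

lemma lintegral_exp_sum_boolReal_le {ι : Type*} [Fintype ι] [DecidableEq ι] (p : unitInterval)
    (S : Finset ι) :
    ∫⁻ b, ENNReal.ofReal (Real.exp (∑ q ∈ S, boolReal (b q)))
      ∂(Measure.pi fun _ : ι => bernoulliMeasure true false p) ≤
      ENNReal.ofReal (Real.exp (2 * p * S.card)) := by
  have h1 : ∀ b : ι → Bool, ENNReal.ofReal (Real.exp (∑ q ∈ S, boolReal (b q))) =
      ∏ q, if q ∈ S then ENNReal.ofReal (Real.exp (boolReal (b q))) else 1 := by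
    intro b
    rw [Real.exp_sum, ENNReal.ofReal_prod_of_nonneg fun _ _ => (Real.exp_pos _).le,
      Finset.prod_ite_mem, Finset.univ_inter]
  simp only [h1]
  rw [lintegral_pi_prod (f := fun q t =>
    if q ∈ S then ENNReal.ofReal (Real.exp (boolReal t)) else 1) _ fun _ => measurable_of_finite _]
  have h2 : ∀ q, ∫⁻ t, (if q ∈ S then ENNReal.ofReal (Real.exp (boolReal t)) else 1)
      ∂bernoulliMeasure true false p ≤
      if q ∈ S then ENNReal.ofReal (Real.exp (2 * p)) else 1 := by
    intro q
    split_ifs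
    · exact lintegral_exp_boolReal_le p
    · simp
  refine (Finset.prod_le_prod' fun q _ => h2 q).trans (le_of_eq ?_)
  rw [Finset.prod_ite_mem, Finset.univ_inter, Finset.prod_const,
    ← ENNReal.ofReal_pow (Real.exp_pos _).le, ← Real.exp_nat_mul]
  congr 2
  ring

/-- An upper bound for all the sums `∑ q ∈ S t, b q` with a small expectation. -/
noncomputable def degreeBound {ι τ : Type*} [Fintype τ] (S : τ → Finset ι) (l : ℝ)
    (b : ι → Bool) : ℝ :=
  l + ∑ t, Real.exp (∑ q ∈ S t, boolReal (b q) - l)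

lemma le_degreeBound {ι τ : Type*} [Fintype τ] (S : τ → Finset ι) (l : ℝ) (b : ι → Bool)
    (t : τ) : ∑ q ∈ S t, boolReal (b q) ≤ degreeBound S l b := by
  have h1 := Real.add_one_le_exp (∑ q ∈ S t, boolReal (b q) - l)
  have h2 := Finset.single_le_sum
    (f := fun t => Real.exp (∑ q ∈ S t, boolReal (b q) - l))
    (fun _ _ => (Real.exp_pos _).le) (Finset.mem_univ t)
  rw [degreeBound]
  linarith

lemma degreeBound_ge {ι τ : Type*} [Fintype τ] (S : τ → Finset ι) (l : ℝ) (b : ι → Bool) :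
    l ≤ degreeBound S l b :=
  le_add_of_nonneg_right (Finset.sum_nonneg fun _ _ => (Real.exp_pos _).le)

/-- The level `l` is high enough that `card τ * exp (2 p N) * exp (-l) ≤ 1`, so the exponential sum
adds at most 1. -/
lemma lintegral_degreeBound_le {ι τ : Type*} [Fintype ι] [DecidableEq ι] [Fintype τ]
    (p : unitInterval) (S : τ → Finset ι) {N : ℕ} (hS : ∀ t, (S t).card = N) {l : ℝ}
    (hl : 0 ≤ l) (hτ : Real.log (Fintype.card τ) + 2 * p * N ≤ l) :
    ∫⁻ b, ENNReal.ofReal (degreeBound S l b)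
      ∂(Measure.pi fun _ : ι => bernoulliMeasure true false p) ≤ ENNReal.ofReal (l + 1) := by
  have h1 : ∀ b : ι → Bool, ENNReal.ofReal (degreeBound S l b) = ENNReal.ofReal l +
      ∑ t, ENNReal.ofReal (Real.exp (-l)) *
        ENNReal.ofReal (Real.exp (∑ q ∈ S t, boolReal (b q))) := by
    intro b
    rw [degreeBound, ENNReal.ofReal_add hl (Finset.sum_nonneg fun _ _ => (Real.exp_pos _).le),
      ENNReal.ofReal_sum_of_nonneg fun _ _ => (Real.exp_pos _).le]
    congr 1
    refine Finset.sum_congr rfl fun t _ => ?_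
    rw [← ENNReal.ofReal_mul (Real.exp_pos _).le, ← Real.exp_add]
    congr 2
    ring
  simp only [h1]
  rw [lintegral_add_left measurable_const,
    lintegral_finsetSum _ fun _ _ => measurable_of_finite _, lintegral_const, measure_univ,
    mul_one, ENNReal.ofReal_add hl zero_le_one]
  gcongr
  have h2 : ∀ t, ∫⁻ b, ENNReal.ofReal (Real.exp (-l)) *
      ENNReal.ofReal (Real.exp (∑ q ∈ S t, boolReal (b q)))
      ∂(Measure.pi fun _ : ι => bernoulliMeasure true false p) ≤
      ENNReal.ofReal (Real.exp (-l) * Real.exp (2 * p * N)) := by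
    intro t
    rw [lintegral_const_mul _ (measurable_of_finite _), ENNReal.ofReal_mul (Real.exp_pos _).le,
      ← hS t]
    gcongr
    exact lintegral_exp_sum_boolReal_le p (S t)
  refine (Finset.sum_le_sum fun t _ => h2 t).trans ?_
  rw [Finset.sum_const, nsmul_eq_mul, ← ENNReal.ofReal_natCast,
    ← ENNReal.ofReal_mul (Nat.cast_nonneg _)]
  refine ENNReal.ofReal_le_ofReal ?_
  rw [Finset.card_univ]
  rcases Nat.eq_zero_or_pos (Fintype.card τ) with h | h
  · rw [h]; simp
  · have hc : (0 : ℝ) < Fintype.card τ := by exact_mod_cast h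
    rw [← Real.exp_log hc, ← Real.exp_add, ← Real.exp_add]
    refine Real.exp_le_one_iff.2 ?_
    linarith

/-- This is the final balance in tenth roots: `m = μ¹⁰`, `k = ν¹⁰`, `p = r¹⁰`, with `T = √(m k p)`.
The logarithms are absorbed through `log x ≤ x - 1` and `ν r ≥ 1`, that is, `k p ≥ 1`; the other
terms use `k ≤ m` and `r ≤ 1`. -/
lemma dense_regime_numeric {μ ν r : ℝ} (hr : 0 < r) (hr1 : r ≤ 1) (hν : 1 ≤ ν) (hνμ : ν ≤ μ)
    (hνr : 1 ≤ ν * r) :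
    (Real.log (ν ^ 10) + 2 * r ^ 10 * μ ^ 10 + 1) +
        (Real.log (μ ^ 10) + 2 * r ^ 10 * ν ^ 10 + 1) / r ^ 3 + ν ^ 10 * r ^ 5 ≤
      23 * (μ ^ 10 * r ^ 10 + μ ^ 5 * ν ^ 5 * r ^ 5) := by
  have hν0 : 0 < ν := by linarith
  have hμ0 : 0 < μ := by linarith
  have hμ1 : 1 ≤ μ := hν.trans hνμ
  set T := μ ^ 5 * ν ^ 5 * r ^ 5 with hT
  have hμ5 : ν ^ 5 ≤ μ ^ 5 := by gcongr
  have h1 : Real.log (ν ^ 10) + 1 ≤ 10 * T := by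
    rw [Real.log_pow]
    have ha := Real.log_le_sub_one_of_pos hν0
    have hb : ν ≤ T := by
      calc ν ≤ μ := hνμ
        _ ≤ μ ^ 5 := le_self_pow₀ hμ1 (by norm_num)
        _ ≤ μ ^ 5 * (ν * r) ^ 5 := le_mul_of_one_le_right (by positivity) (one_le_pow₀ hνr)
        _ = T := by rw [hT]; ring
    push_cast
    linarith
  have h2 : (Real.log (μ ^ 10) + 1) / r ^ 3 ≤ 10 * T := by
    rw [div_le_iff₀ (by positivity), Real.log_pow]
    have ha := Real.log_le_sub_one_of_pos hμ0
    have hb : μ ≤ T * r ^ 3 := by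
      calc μ ≤ μ * ((ν * r) ^ 8 * ν) :=
            le_mul_of_one_le_right hμ0.le (one_le_mul_of_one_le_of_one_le (one_le_pow₀ hνr) hν)
        _ = μ * ν ^ 4 * (ν ^ 5 * r ^ 8) := by ring
        _ ≤ μ * μ ^ 4 * (ν ^ 5 * r ^ 8) := by gcongr
        _ = T * r ^ 3 := by rw [hT]; ring
    push_cast
    linarith
  have h3 : 2 * r ^ 10 * ν ^ 10 / r ^ 3 ≤ 2 * T := by
    have : 2 * r ^ 10 * ν ^ 10 / r ^ 3 = 2 * (ν ^ 5 * ν ^ 5 * r ^ 5 * r ^ 2) := by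
      field_simp
    rw [this]
    have hb : ν ^ 5 * ν ^ 5 * r ^ 5 * r ^ 2 ≤ μ ^ 5 * ν ^ 5 * r ^ 5 * 1 := by
      gcongr
      exact pow_le_one₀ hr.le hr1
    rw [hT]
    linarith
  have h4 : ν ^ 10 * r ^ 5 ≤ T := by
    calc ν ^ 10 * r ^ 5 = ν ^ 5 * ν ^ 5 * r ^ 5 := by ring
      _ ≤ T := by rw [hT]; gcongr
  have h5 : (Real.log (μ ^ 10) + 2 * r ^ 10 * ν ^ 10 + 1) / r ^ 3 =
      (Real.log (μ ^ 10) + 1) / r ^ 3 + 2 * r ^ 10 * ν ^ 10 / r ^ 3 := by ring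
  have h6 : 0 ≤ μ ^ 10 * r ^ 10 := by positivity
  rw [h5]
  linarith

/-- Second moment of the operator norm of a sparse Gaussian matrix when `k p ≥ 1`. -/
lemma lintegral_opNorm_sq_sparse_of_one_le {p : unitInterval} (hkm : k ≤ m)
    (hkp : 1 ≤ (k : ℝ) * p) :
    ∫⁻ b, ∫⁻ g, ENNReal.ofReal (‖maskMatrix b g‖ ^ 2)
        ∂(Measure.pi fun _ : Fin m × Fin k => gaussianReal 0 1)
        ∂(Measure.pi fun _ : Fin m × Fin k => bernoulliMeasure true false p) ≤
      ENNReal.ofReal (23 * 10 ^ 4 * (m * p + √(m * k * p))) := by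
  have hk0 : 0 < k := by
    rcases Nat.eq_zero_or_pos k with h | h
    · rw [h] at hkp; norm_num at hkp
    · exact h
  have hm0 : 0 < m := hk0.trans_le hkm
  have hp0 : (0 : ℝ) < p := by
    rcases p.2.1.eq_or_lt with h | h
    · rw [← h] at hkp; norm_num at hkp
    · exact h
  set r := (p : ℝ) ^ (1 / 10 : ℝ) with hrdef
  set μ := (m : ℝ) ^ (1 / 10 : ℝ) with hμdef
  set ν := (k : ℝ) ^ (1 / 10 : ℝ) with hνdef
  have hroot : ∀ x : ℝ, 0 ≤ x → (x ^ (1 / 10 : ℝ)) ^ 10 = x := fun x hx => by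
    rw [← Real.rpow_natCast, ← Real.rpow_mul hx]; norm_num
  have hr10 : r ^ 10 = p := hroot _ hp0.le
  have hμ10 : μ ^ 10 = m := hroot _ (Nat.cast_nonneg _)
  have hν10 : ν ^ 10 = k := hroot _ (Nat.cast_nonneg _)
  have hr : 0 < r := Real.rpow_pos_of_pos hp0 _
  have hr1 : r ≤ 1 := Real.rpow_le_one hp0.le p.2.2 (by norm_num)
  have hν1 : 1 ≤ ν := Real.one_le_rpow (by exact_mod_cast hk0) (by norm_num)
  have hνμ : ν ≤ μ :=
    Real.rpow_le_rpow (Nat.cast_nonneg _) (by exact_mod_cast hkm) (by norm_num)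
  have hνr : 1 ≤ ν * r := by
    rw [hνdef, hrdef, ← Real.mul_rpow (Nat.cast_nonneg _) hp0.le]
    exact Real.one_le_rpow hkp (by norm_num)
  have hμ0 : 0 < μ := by linarith
  -- In each threshold the logarithm pays for the union over columns or rows, and the second term
  -- for the exponential moment of one count.
  set lC := Real.log k + 2 * p * m with hlC
  set lR := Real.log m + 2 * p * k with hlR
  have hlogk : 0 ≤ Real.log k := Real.log_natCast_nonneg k
  have hlogm : 0 ≤ Real.log m := Real.log_natCast_nonneg m
  have hlC0 : 0 ≤ lC := by positivity
  have hlR0 : 0 < lR := by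
    have : 0 < (p : ℝ) * k := by positivity
    rw [hlR]; linarith
  set SC : Fin k → Finset (Fin m × Fin k) := fun j => Finset.univ ×ˢ {j} with hSC
  set SR : Fin m → Finset (Fin m × Fin k) := fun i => {i} ×ˢ Finset.univ with hSR
  have hb : ∀ b : Fin m × Fin k → Bool, ∫⁻ g, ENNReal.ofReal (‖maskMatrix b g‖ ^ 2)
      ∂(Measure.pi fun _ : Fin m × Fin k => gaussianReal 0 1) ≤
      ENNReal.ofReal (10 ^ 4) * ENNReal.ofReal (degreeBound SC lC b) +
        ENNReal.ofReal (10 ^ 4 / r ^ 3) * ENNReal.ofReal (degreeBound SR lR b) +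
        ENNReal.ofReal (10 ^ 4 * (k * r ^ 5)) := by
    intro b
    have hCb : 0 ≤ degreeBound SC lC b := hlC0.trans (degreeBound_ge _ _ _)
    have hRb : 0 < degreeBound SR lR b := hlR0.trans_le (degreeBound_ge _ _ _)
    refine (lintegral_opNorm_sq_maskMatrix_le (b := b) hr hr1 (by rw [hr10]; exact hkp) hCb hRb
      (fun j => ?_) fun i => ?_).trans (le_of_eq ?_)
    · have := le_degreeBound SC lC b j
      simpa [hSC, Finset.sum_product] using this
    · have := le_degreeBound SR lR b i
      simpa [hSR, Finset.sum_product] using this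
    · rw [← ENNReal.ofReal_mul (by positivity), ← ENNReal.ofReal_mul (by positivity),
        ← ENNReal.ofReal_add (by positivity) (by positivity),
        ← ENNReal.ofReal_add (by positivity) (by positivity)]
      congr 1
      ring
  refine (lintegral_mono hb).trans ?_
  rw [lintegral_add_right _ measurable_const, lintegral_add_left (measurable_of_finite _),
    lintegral_const_mul _ (measurable_of_finite _), lintegral_const_mul _ (measurable_of_finite _),
    lintegral_const, measure_univ, mul_one]
  have hEC := lintegral_degreeBound_le p SC (N := m) (fun j => by simp [hSC]) hlC0
    (by rw [Fintype.card_fin])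
  have hER := lintegral_degreeBound_le p SR (N := k) (fun j => by simp [hSR]) hlR0.le
    (by rw [Fintype.card_fin])
  calc _ ≤ ENNReal.ofReal (10 ^ 4) * ENNReal.ofReal (lC + 1) +
        ENNReal.ofReal (10 ^ 4 / r ^ 3) * ENNReal.ofReal (lR + 1) +
        ENNReal.ofReal (10 ^ 4 * (k * r ^ 5)) := by gcongr
    _ = ENNReal.ofReal (10 ^ 4 * ((lC + 1) + (lR + 1) / r ^ 3 + k * r ^ 5)) := by
      rw [← ENNReal.ofReal_mul (by positivity), ← ENNReal.ofReal_mul (by positivity),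
        ← ENNReal.ofReal_add (by positivity) (by positivity),
        ← ENNReal.ofReal_add (by positivity) (by positivity)]
      congr 1
      ring
    _ ≤ _ := by
      refine ENNReal.ofReal_le_ofReal ?_
      have hnum := dense_regime_numeric hr hr1 hν1 hνμ hνr
      have hsqrt : √((m : ℝ) * k * p) = μ ^ 5 * ν ^ 5 * r ^ 5 := by
        rw [← hμ10, ← hν10, ← hr10, show μ ^ 10 * ν ^ 10 * r ^ 10 =
          (μ ^ 5 * ν ^ 5 * r ^ 5) ^ 2 by ring]
        exact Real.sqrt_sq (by positivity)
      rw [hμ10, hν10, hr10] at hnum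
      rw [hsqrt, hlC, hlR]
      linarith

end RandomMask

/-! ### Gram matrix bound from second and fourth moments -/

section SecondMoment

variable {m k : ℕ}

/-- Write `‖A v‖²` as `a ‖v‖²` plus the quadratic form of the Gram matrix minus `a`. Applying `x y ≤
(t x² + y² / t) / 2` entrywise replaces the Frobenius norm by its square, whose expectation is
computable. -/
lemma sq_opNorm_le_gram (A : Matrix (Fin m) (Fin k) ℝ) {a t : ℝ} (ha : 0 ≤ a) (ht : 0 < t) :
    ‖A‖ ^ 2 ≤ a + (t +
      (∑ j, ∑ l, ((∑ i, A i j * A i l) - if j = l then a else 0) ^ 2) / t) / 2 := by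
  set F := ∑ j, ∑ l, ((∑ i, A i j * A i l) - if j = l then a else 0) ^ 2 with hF
  have hF0 : 0 ≤ F := by positivity
  refine sq_opNorm_le A (by positivity) fun v hv => ?_
  have h1 : ∑ i, (∑ j, A i j * v j) ^ 2 = ∑ j, ∑ l, v j * v l * ∑ i, A i j * A i l := by
    simp only [sq, Finset.sum_mul_sum]
    rw [Finset.sum_comm]
    refine Finset.sum_congr rfl fun j _ => ?_
    rw [Finset.sum_comm]
    refine Finset.sum_congr rfl fun l _ => ?_
    rw [Finset.mul_sum]
    exact Finset.sum_congr rfl fun i _ => by ring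
  have h2 : ∀ j l, v j * v l * ∑ i, A i j * A i l ≤
      (if j = l then a * v j ^ 2 else 0) + (t * (v j ^ 2 * v l ^ 2) +
        ((∑ i, A i j * A i l) - if j = l then a else 0) ^ 2 / t) / 2 := by
    intro j l
    set G := ∑ i, A i j * A i l
    have h3 : ∀ x y : ℝ, x * y ≤ (t * x ^ 2 + y ^ 2 / t) / 2 := by
      intro x y
      have h4 : (t * x ^ 2 + y ^ 2 / t) / 2 - x * y = (t * x - y) ^ 2 / (2 * t) := by
        field_simp
        ring
      have h5 : 0 ≤ (t * x - y) ^ 2 / (2 * t) := by positivity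
      linarith
    have h6 := h3 (v j * v l) (G - if j = l then a else 0)
    rw [mul_pow] at h6
    have h7 : v j * v l * G = (if j = l then a * v j ^ 2 else 0) +
        v j * v l * (G - if j = l then a else 0) := by
      split_ifs with h
      · subst h; ring
      · ring
    linarith
  rw [h1]
  refine (Finset.sum_le_sum fun j _ => Finset.sum_le_sum fun l _ => h2 j l).trans ?_
  have hv0 : 0 ≤ ∑ j, v j ^ 2 := by positivity
  have e1 : ∑ j, v j ^ 2 * ∑ l, v l ^ 2 = (∑ j, v j ^ 2) ^ 2 := by
    rw [← Finset.sum_mul, sq]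
  simp only [Finset.sum_add_distrib, Finset.sum_ite_eq, Finset.mem_univ, if_true,
    ← Finset.sum_div, ← Finset.mul_sum]
  rw [e1, ← hF]
  have h8 : a * ∑ j, v j ^ 2 ≤ a * 1 := by gcongr
  have h9 : t * (∑ j, v j ^ 2) ^ 2 ≤ t * 1 := by
    gcongr
    exact pow_le_one₀ hv0 hv
  linarith

/-- Second moment of the operator norm of a random matrix with independent centred entries of
law `ν`, in terms of the second and fourth moments of `ν`. -/
lemma lintegral_opNorm_sq_pi_le (ν : Measure ℝ) [IsProbabilityMeasure ν]
    (h4 : Integrable (fun x => x ^ 4) ν) (h1 : ∫ x, x ∂ν = 0) {t : ℝ} (ht : 0 < t) :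
    ∫⁻ B, ENNReal.ofReal (‖(ofPairs B : Matrix (Fin m) (Fin k) ℝ)‖ ^ 2)
      ∂(Measure.pi fun _ : Fin m × Fin k => ν) ≤
      ENNReal.ofReal (m * (∫ x, x ^ 2 ∂ν) +
        (t + m * (k ^ 2 * (∫ x, x ^ 2 ∂ν) ^ 2 + k * ∫ x, x ^ 4 ∂ν) / t) / 2) := by
  set P := Measure.pi fun _ : Fin m × Fin k => ν with hP
  set v := ∫ x, x ^ 2 ∂ν with hv
  set κ := ∫ x, x ^ 4 ∂ν with hκ
  have hv0 : 0 ≤ v := integral_nonneg fun _ => sq_nonneg _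
  have hκ0 : 0 ≤ κ := integral_nonneg fun _ => by positivity
  have hlaw : ∀ q : Fin m × Fin k, HasLaw (fun B : Fin m × Fin k → ℝ => B q) ν P := fun q =>
    (measurePreserving_eval (fun _ : Fin m × Fin k => ν) q).hasLaw
  have hmom : ∀ (q : Fin m × Fin k) (a : ℕ), ∫ B, B q ^ a ∂P = ∫ x, x ^ a ∂ν := fun q a =>
    (hlaw q).integral_comp (f := fun x => x ^ a) (by fun_prop)
  have hint4 : ∀ q : Fin m × Fin k, Integrable (fun B : Fin m × Fin k → ℝ => B q ^ 4) P :=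
    fun q => (measurePreserving_eval (fun _ : Fin m × Fin k => ν) q).integrable_comp_of_integrable
      h4
  have hind : iIndepFun (fun (q : Fin m × Fin k) (B : Fin m × Fin k → ℝ) => B q) P :=
    iIndepFun_pi (X := fun _ x => x) fun _ => aemeasurable_id
  have hmeas : ∀ q : Fin m × Fin k, Measurable fun B : Fin m × Fin k → ℝ => B q :=
    fun q => measurable_pi_apply q
  have hprod : ∀ q q' : Fin m × Fin k, MemLp (fun B : Fin m × Fin k → ℝ => B q * B q') 2 P := by
    intro q q'
    refine (memLp_two_iff_integrable_sq (by fun_prop)).2 ?_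
    refine ((hint4 q).add (hint4 q')).mono' (by fun_prop) (ae_of_all _ fun B => ?_)
    rw [Real.norm_of_nonneg (sq_nonneg _), Pi.add_apply, mul_pow]
    nlinarith [sq_nonneg (B q ^ 2 - B q' ^ 2), sq_nonneg (B q ^ 2), sq_nonneg (B q' ^ 2)]
  have hvar : ∀ q q' : Fin m × Fin k, Var[fun B : Fin m × Fin k → ℝ => B q * B q'; P] ≤
      if q = q' then κ else v ^ 2 := by
    intro q q'
    refine (variance_le_expectation_sq (by fun_prop)).trans (le_of_eq ?_)
    simp only [Pi.pow_apply, mul_pow]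
    split_ifs with h
    · subst h
      rw [hκ, ← hmom q 4]
      exact integral_congr_ae (ae_of_all _ fun B => by ring)
    · have hi : IndepFun (fun B : Fin m × Fin k → ℝ => B q ^ 2) (fun B => B q' ^ 2) P :=
        (hind.indepFun h).comp (φ := fun x => x ^ 2) (ψ := fun x => x ^ 2) (by fun_prop)
          (by fun_prop)
      rw [hi.integral_fun_mul_eq_mul_integral ((hmeas q).pow_const 2).aestronglyMeasurable
        ((hmeas q').pow_const 2).aestronglyMeasurable, hmom, hmom, ← sq]
  have hmean : ∀ q q' : Fin m × Fin k, ∫ B, B q * B q' ∂P = if q = q' then v else 0 := by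
    intro q q'
    split_ifs with h
    · subst h
      rw [hv, ← hmom q 2]
      exact integral_congr_ae (ae_of_all _ fun B => by ring)
    · rw [(hind.indepFun h).integral_fun_mul_eq_mul_integral (hmeas q).aestronglyMeasurable
        (hmeas q').aestronglyMeasurable]
      have := hmom q 1
      simp only [pow_one, h1] at this
      rw [this, zero_mul]
  have hpair : ∀ (i : Fin m) (j l : Fin k), ((i, j) = (i, l)) = (j = l) := fun i j l => by simp
  have hG : ∀ j l : Fin k, ∫⁻ B, ENNReal.ofReal
      (((∑ i, B (i, j) * B (i, l)) - if j = l then m * v else 0) ^ 2) ∂P ≤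
      ENNReal.ofReal (m * if j = l then κ else v ^ 2) := by
    intro j l
    have hL : MemLp (∑ i, fun B : Fin m × Fin k → ℝ => B (i, j) * B (i, l)) 2 P :=
      memLp_finsetSum' _ fun i _ => hprod _ _
    have hE : P[∑ i, fun B : Fin m × Fin k → ℝ => B (i, j) * B (i, l)] =
        if j = l then m * v else 0 := by
      simp only [Finset.sum_apply]
      rw [integral_finsetSum _ fun i _ => (hprod _ _).integrable (by norm_num)]
      simp only [hmean, hpair]
      split_ifs <;> simp
    -- For two fixed columns, products from different rows involve disjoint sets of entries, hence
    -- are independent and their variances add.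
    have hV := IndepFun.variance_sum (μ := P) (s := Finset.univ)
      (X := fun (i : Fin m) (B : Fin m × Fin k → ℝ) => B (i, j) * B (i, l))
      (fun i _ => hprod _ _) (fun i _ i' _ hii => hind.indepFun_mul_mul hmeas (i, j) (i, l)
        (i', j) (i', l) (by simp [hii]) (by simp [hii]) (by simp [hii]) (by simp [hii]))
    have hsq : Integrable (fun B : Fin m × Fin k → ℝ =>
        ((∑ i, B (i, j) * B (i, l)) - if j = l then m * v else 0) ^ 2) P := by
      have := (hL.sub (memLp_const (if j = l then m * v else 0))).integrable_sq
      simpa using this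
    rw [← ofReal_integral_eq_lintegral_ofReal hsq (ae_of_all _ fun B => sq_nonneg _)]
    refine ENNReal.ofReal_le_ofReal ?_
    rw [variance_eq_integral hL.aemeasurable, hE] at hV
    simp only [Finset.sum_apply] at hV
    rw [hV]
    refine (Finset.sum_le_sum fun i _ => hvar (i, j) (i, l)).trans (le_of_eq ?_)
    simp only [hpair]
    simp
  have hpt : ∀ B : Fin m × Fin k → ℝ,
      ENNReal.ofReal (‖(ofPairs B : Matrix (Fin m) (Fin k) ℝ)‖ ^ 2) ≤
      ENNReal.ofReal (m * v + t / 2) + ENNReal.ofReal (1 / (2 * t)) * ∑ j : Fin k, ∑ l : Fin k,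
        ENNReal.ofReal (((∑ i, B (i, j) * B (i, l)) - if j = l then m * v else 0) ^ 2) := by
    intro B
    have hs0 : 0 ≤ ∑ j : Fin k, ∑ l : Fin k,
        ((∑ i, B (i, j) * B (i, l)) - if j = l then m * v else 0) ^ 2 := by positivity
    have e : ∑ j : Fin k, ∑ l : Fin k, ENNReal.ofReal
        (((∑ i, B (i, j) * B (i, l)) - if j = l then m * v else 0) ^ 2) =
        ENNReal.ofReal (∑ j : Fin k, ∑ l : Fin k,
          ((∑ i, B (i, j) * B (i, l)) - if j = l then m * v else 0) ^ 2) := by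
      rw [ENNReal.ofReal_sum_of_nonneg fun j _ => by positivity]
      refine Finset.sum_congr rfl fun j _ => ?_
      rw [ENNReal.ofReal_sum_of_nonneg fun l _ => sq_nonneg _]
    rw [e, ← ENNReal.ofReal_mul (by positivity), ← ENNReal.ofReal_add (by positivity)
      (by positivity)]
    refine ENNReal.ofReal_le_ofReal ?_
    refine (sq_opNorm_le_gram (ofPairs B) (a := m * v) (by positivity) ht).trans (le_of_eq ?_)
    simp only [ofPairs]
    field_simp
    ring
  refine (lintegral_mono hpt).trans ?_
  rw [lintegral_add_left measurable_const, lintegral_const_mul _ (by fun_prop), lintegral_const,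
    measure_univ, mul_one, lintegral_finsetSum _ fun j _ => by fun_prop]
  have hsum : ∑ j : Fin k, ∫⁻ B, ∑ l : Fin k, ENNReal.ofReal
      (((∑ i, B (i, j) * B (i, l)) - if j = l then m * v else 0) ^ 2) ∂P ≤
      ENNReal.ofReal (m * (k ^ 2 * v ^ 2 + k * κ)) := by
    calc _ ≤ ∑ j : Fin k, ∑ l : Fin k, ENNReal.ofReal (m * if j = l then κ else v ^ 2) := by
          refine Finset.sum_le_sum fun j _ => ?_
          rw [lintegral_finsetSum _ fun l _ => by fun_prop]
          exact Finset.sum_le_sum fun l _ => hG j l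
      _ ≤ ∑ j : Fin k, ∑ l : Fin k, ENNReal.ofReal (m * ((if j = l then κ else 0) + v ^ 2)) := by
          gcongr with j _ l _
          split_ifs
          · have := sq_nonneg v
            linarith
          · linarith
      _ = _ := by
          have h0 : ∀ j l : Fin k, 0 ≤ (m : ℝ) * ((if j = l then κ else 0) + v ^ 2) := by
            intro j l
            split_ifs <;> positivity
          simp only [← ENNReal.ofReal_sum_of_nonneg fun l _ => h0 _ l]
          rw [← ENNReal.ofReal_sum_of_nonneg fun j _ => Finset.sum_nonneg fun l _ => h0 j l]
          congr 1
          simp only [← Finset.mul_sum, Finset.sum_add_distrib, Finset.sum_ite_eq,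
            Finset.mem_univ, if_true, Finset.sum_const, Finset.card_univ, Fintype.card_fin,
            nsmul_eq_mul]
          ring
  calc _ ≤ ENNReal.ofReal (m * v + t / 2) + ENNReal.ofReal (1 / (2 * t)) *
        ENNReal.ofReal (m * (k ^ 2 * v ^ 2 + k * κ)) := by gcongr
    _ = _ := by
      rw [← ENNReal.ofReal_mul (by positivity), ← ENNReal.ofReal_add (by positivity)
        (by positivity)]
      congr 1
      field_simp
      ring

end SecondMoment

/-! ### Sparse Gaussian entries: moments and the two regimes combined -/

section SparseGaussian

variable {m k : ℕ}

lemma measurable_mask : Measurable fun x : Bool × ℝ => if x.1 = true then x.2 else 0 :=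
  Measurable.ite (measurable_fst (measurableSet_singleton true)) measurable_snd measurable_const

/-- The law of `b * g` for independent `b ∼ Ber(p)` and `g ∼ N(0, 1)`. -/
noncomputable def sparseGaussian (p : unitInterval) : Measure ℝ :=
  ((bernoulliMeasure true false p).prod (gaussianReal 0 1)).map
    fun x => if x.1 = true then x.2 else 0

instance (p : unitInterval) : IsProbabilityMeasure (sparseGaussian p) :=
  Measure.isProbabilityMeasure_map measurable_mask.aemeasurable

lemma sparseGaussian_eq (p : unitInterval) : sparseGaussian p =
    ENNReal.ofReal p • gaussianReal 0 1 + ENNReal.ofReal (1 - p) • Measure.dirac 0 := by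
  refine Measure.ext_of_lintegral _ fun f hf => ?_
  have hm : Measurable fun x : Bool × ℝ => f (if x.1 = true then x.2 else 0) :=
    hf.comp measurable_mask
  rw [sparseGaussian, lintegral_map hf measurable_mask, lintegral_prod _ hm.aemeasurable,
    lintegral_bernoulli, lintegral_add_measure, lintegral_smul_measure, lintegral_smul_measure, lintegral_dirac]
  simp

lemma integrable_sparseGaussian (p : unitInterval) {f : ℝ → ℝ}
    (hf : Integrable f (gaussianReal 0 1)) : Integrable f (sparseGaussian p) := by
  rw [sparseGaussian_eq]
  refine (hf.smul_measure ENNReal.ofReal_ne_top).add_measure ?_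
  exact (integrable_dirac (by simp)).smul_measure ENNReal.ofReal_ne_top

lemma integral_sparseGaussian (p : unitInterval) {f : ℝ → ℝ}
    (hf : Integrable f (gaussianReal 0 1)) (hf0 : f 0 = 0) :
    ∫ x, f x ∂sparseGaussian p = p * ∫ x, f x ∂gaussianReal 0 1 := by
  rw [sparseGaussian_eq, integral_add_measure (hf.smul_measure ENNReal.ofReal_ne_top)
    ((integrable_dirac (by simp)).smul_measure ENNReal.ofReal_ne_top), integral_smul_measure,
    integral_smul_measure, integral_dirac, hf0, ENNReal.toReal_ofReal p.2.1]
  simp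

lemma integrable_pow_gaussianReal (a : ℕ) :
    Integrable (fun x : ℝ => x ^ a) (gaussianReal 0 1) := by
  have h : MemLp (id : ℝ → ℝ) a (gaussianReal 0 1) := by
    exact_mod_cast memLp_id_gaussianReal (μ := 0) (v := 1) (a : ℝ≥0)
  have h2 := h.integrable_norm_pow'
  refine h2.mono (by fun_prop) (ae_of_all _ fun x => ?_)
  simp

lemma integral_sq_gaussianReal : ∫ x, x ^ 2 ∂gaussianReal 0 1 = 1 := by
  have h := variance_fun_id_gaussianReal (μ := 0) (v := 1)
  rw [variance_of_integral_eq_zero (by fun_prop) (by simp)] at h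
  simpa using h

/-- A crude constant suffices: `x⁴ ≤ 32 exp (x² / 4)`, and the exponential moment is at most `exp (1
/ 2) ≤ 2`. -/
lemma integral_pow_four_gaussianReal_le : ∫ x, x ^ 4 ∂gaussianReal 0 1 ≤ 64 := by
  rw [integral_eq_lintegral_of_nonneg_ae (ae_of_all _ fun x => by positivity) (by fun_prop)]
  refine ENNReal.toReal_le_of_le_ofReal (by norm_num) ?_
  calc ∫⁻ x, ENNReal.ofReal (x ^ 4) ∂gaussianReal 0 1
      ≤ ∫⁻ x, ENNReal.ofReal 32 * ENNReal.ofReal (Real.exp (1 / 4 * x ^ 2)) ∂gaussianReal 0 1 := by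
        refine lintegral_mono fun x => ?_
        rw [← ENNReal.ofReal_mul (by norm_num)]
        refine ENNReal.ofReal_le_ofReal ?_
        have := Real.quadratic_le_exp_of_nonneg (x := 1 / 4 * x ^ 2) (by positivity)
        nlinarith [sq_nonneg x]
    _ ≤ ENNReal.ofReal 32 * ENNReal.ofReal (Real.exp (2 * (1 / 4))) := by
        rw [lintegral_const_mul _ (by fun_prop)]
        gcongr
        exact lintegral_exp_mul_sq_gaussian_le (by norm_num) le_rfl
    _ ≤ ENNReal.ofReal 64 := by
        rw [← ENNReal.ofReal_mul (by norm_num)]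
        refine ENNReal.ofReal_le_ofReal ?_
        have h1 : Real.exp (2 * (1 / 4)) ≤ 2 := by
          refine le_of_sq_le_sq ?_ (by norm_num)
          rw [← Real.exp_nat_mul]
          have := Real.exp_one_lt_d9
          norm_num
          linarith
        linarith

/-- Here `t = √(m k p)` balances the Gram bound: `k p ≤ 1` makes the squared Frobenius error at most
`65 m k p = 65 t²`. -/
lemma lintegral_opNorm_sq_sparse_of_le_one {p : unitInterval} (hp : (0 : ℝ) < p) (hk0 : 0 < k)
    (hm0 : 0 < m) (hkp : (k : ℝ) * p ≤ 1) :
    ∫⁻ B, ENNReal.ofReal (‖(ofPairs B : Matrix (Fin m) (Fin k) ℝ)‖ ^ 2)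
      ∂(Measure.pi fun _ : Fin m × Fin k => sparseGaussian p) ≤
      ENNReal.ofReal (33 * (m * p + √(m * k * p))) := by
  have hI := fun a => integrable_pow_gaussianReal a
  have e1 : ∫ x, x ∂sparseGaussian p = 0 := by
    have := integral_sparseGaussian p (f := fun x => x ^ 1) (hI 1) (by simp)
    simpa using this
  have e2 : ∫ x, x ^ 2 ∂sparseGaussian p = p := by
    rw [integral_sparseGaussian p (hI 2) (by simp), integral_sq_gaussianReal, mul_one]
  have e4 : ∫ x, x ^ 4 ∂sparseGaussian p ≤ 64 * p := by
    rw [integral_sparseGaussian p (hI 4) (by simp), mul_comm]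
    exact mul_le_mul_of_nonneg_right integral_pow_four_gaussianReal_le hp.le
  have ht : 0 < √((m : ℝ) * k * p) := Real.sqrt_pos.2 (by positivity)
  refine (lintegral_opNorm_sq_pi_le (sparseGaussian p) (integrable_sparseGaussian p (hI 4)) e1
    ht).trans (ENNReal.ofReal_le_ofReal ?_)
  rw [e2]
  set t := √((m : ℝ) * k * p) with htdef
  have ht2 : t * t = m * k * p := Real.mul_self_sqrt (by positivity)
  have h1 : (m : ℝ) * (k ^ 2 * (p : ℝ) ^ 2 + k * ∫ x, x ^ 4 ∂sparseGaussian p) / t ≤ 65 * t := by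
    rw [div_le_iff₀ ht]
    calc (m : ℝ) * (k ^ 2 * (p : ℝ) ^ 2 + k * ∫ x, x ^ 4 ∂sparseGaussian p)
        ≤ m * (k * p * (k * p) + k * (64 * p)) := by
          rw [← mul_pow, sq]
          gcongr
      _ ≤ m * (k * p * 1 + k * (64 * p)) := by gcongr
      _ = 65 * (m * k * p) := by ring
      _ = 65 * t * t := by rw [mul_assoc 65 t t, ht2]
  have : 0 ≤ (m : ℝ) * p := by positivity
  linarith

/-- Second moment of the operator norm of a matrix with independent `b * g` entries. -/
lemma lintegral_opNorm_sq_sparse_le {p : unitInterval} (hp : (0 : ℝ) < p) (hk0 : 0 < k)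
    (hkm : k ≤ m) :
    ∫⁻ B, ENNReal.ofReal (‖(ofPairs B : Matrix (Fin m) (Fin k) ℝ)‖ ^ 2)
      ∂(Measure.pi fun _ : Fin m × Fin k => sparseGaussian p) ≤
      ENNReal.ofReal (23 * 10 ^ 4 * (m * p + √(m * k * p))) := by
  rcases le_total ((k : ℝ) * p) 1 with h | h
  · refine (lintegral_opNorm_sq_sparse_of_le_one hp hk0 (hk0.trans_le hkm) h).trans
      (ENNReal.ofReal_le_ofReal ?_)
    gcongr
    norm_num
  · refine le_trans (le_of_eq ?_) (lintegral_opNorm_sq_sparse_of_one_le hkm h)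
    have hm1 := measurable_opNorm_ofPairs_sq (m := m) (k := k)
    have hmask : Measurable fun (x : Fin m × Fin k → Bool × ℝ) (q : Fin m × Fin k) =>
        if (x q).1 = true then (x q).2 else 0 :=
      measurable_pi_lambda _ fun q => measurable_mask.comp (measurable_pi_apply q)
    have hmask2 : Measurable fun (x : (Fin m × Fin k → Bool) × (Fin m × Fin k → ℝ))
        (q : Fin m × Fin k) => if x.1 q = true then x.2 q else 0 :=
      measurable_pi_lambda _ fun q => by
        have h := measurable_mask.comp
          (((measurable_pi_apply q).comp measurable_fst).prodMk
            ((measurable_pi_apply q).comp measurable_snd) :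
            Measurable fun x : (Fin m × Fin k → Bool) × (Fin m × Fin k → ℝ) => (x.1 q, x.2 q))
        exact h
    -- The entries are a pushforward of independent pairs (bit, Gaussian). Separating bits from
    -- Gaussians turns the integral into an iterated one with the mask fixed inside.
    have hpi : (Measure.pi fun _ : Fin m × Fin k => sparseGaussian p) =
        (Measure.pi fun _ : Fin m × Fin k =>
          (bernoulliMeasure true false p).prod (gaussianReal 0 1)).map
          fun x q => if (x q).1 = true then (x q).2 else 0 :=
      (Measure.pi_map_pi fun _ => measurable_mask.aemeasurable).symm
    rw [hpi, lintegral_map hm1.ennreal_ofReal hmask]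
    have hmp := measurePreserving_arrowProdEquivProdArrow Bool ℝ (Fin m × Fin k)
      (fun _ => bernoulliMeasure true false p) (fun _ => gaussianReal 0 1)
    have hF : Measurable fun x : (Fin m × Fin k → Bool) × (Fin m × Fin k → ℝ) =>
        ENNReal.ofReal (‖(ofPairs fun q => if x.1 q = true then x.2 q else 0 :
          Matrix (Fin m) (Fin k) ℝ)‖ ^ 2) := hm1.ennreal_ofReal.comp hmask2
    have := hmp.lintegral_comp hF
    rw [lintegral_prod _ hF.aemeasurable] at this
    exact this

end SparseGaussian

/-! ### Law of a pruned weight -/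

section PrunedEntry

/-- The probability `√(d / (d + 2))` that a Gaussian weight is pruned. -/
noncomputable def meanPruneProb (d : ℝ≥0) : unitInterval :=
  ⟨√((d : ℝ) / (d + 2)), Real.sqrt_nonneg _, by
    rw [Real.sqrt_le_one]
    have : (0 : ℝ) ≤ d := d.2
    rw [div_le_one (by positivity)]
    linarith⟩

/-- The variance of a pruned Gaussian weight. -/
noncomputable def prunedVar (d Ψ : ℝ≥0) : ℝ≥0 := Ψ * d / (d + 2)

variable {d Ψ : ℝ≥0}

lemma meanPruneProb_pos (hd : 0 < d) : (0 : ℝ) < meanPruneProb d :=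
  Real.sqrt_pos.2 (by positivity)

lemma meanPruneProb_sq (d : ℝ≥0) : (meanPruneProb d : ℝ) ^ 2 = d / (d + 2) :=
  Real.sq_sqrt (by positivity)

lemma coe_prunedVar (d Ψ : ℝ≥0) : (prunedVar d Ψ : ℝ) = Ψ * (meanPruneProb d : ℝ) ^ 2 := by
  rw [meanPruneProb_sq, prunedVar]
  push_cast
  ring

lemma prunedVar_pos (hd : 0 < d) (hΨ : 0 < Ψ) : 0 < prunedVar d Ψ := by
  unfold prunedVar
  positivity

/-- The exponents add to a Gaussian exponent, `1 / (2 Ψ) + 1 / (d Ψ) = 1 / (2 v)`; the ratio of the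
normalizations is `√(v / Ψ) = p`. -/
lemma gaussianPDFReal_mul_pruneProb (hd : 0 < d) (hΨ : 0 < Ψ) (a : ℝ) :
    gaussianPDFReal 0 Ψ a * pruneProb d Ψ a =
      meanPruneProb d * gaussianPDFReal 0 (prunedVar d Ψ) a := by
  have hd' : (0 : ℝ) < d := hd
  have hΨ' : (0 : ℝ) < Ψ := hΨ
  have hp := meanPruneProb_pos hd
  have hsq : √(2 * Real.pi * (prunedVar d Ψ : ℝ)) = √(2 * Real.pi * Ψ) * meanPruneProb d := by
    rw [coe_prunedVar, ← mul_assoc, Real.sqrt_mul (by positivity), Real.sqrt_sq hp.le]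
  have hexp : -(a - 0) ^ 2 / (2 * (Ψ : ℝ)) + -a ^ 2 / ((d : ℝ) * Ψ) =
      -(a - 0) ^ 2 / (2 * (prunedVar d Ψ : ℝ)) := by
    rw [coe_prunedVar, meanPruneProb_sq]
    field_simp
    ring
  simp only [gaussianPDFReal, pruneProb]
  rw [hsq, ← hexp, Real.exp_add]
  have := Real.pi_pos
  field_simp

lemma lintegral_pruneProb_mul (hd : 0 < d) (hΨ : 0 < Ψ) {f : ℝ → ENNReal} (hf : Measurable f) :
    ∫⁻ a, ENNReal.ofReal (pruneProb d Ψ a) * f a ∂gaussianReal 0 Ψ =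
      ENNReal.ofReal (meanPruneProb d) * ∫⁻ a, f a ∂gaussianReal 0 (prunedVar d Ψ) := by
  have hm : Measurable fun a => ENNReal.ofReal (pruneProb d Ψ a : ℝ) :=
    (measurable_subtype_coe.comp (continuous_pruneProb d Ψ).measurable).ennreal_ofReal
  have hmf : Measurable fun a => ENNReal.ofReal (pruneProb d Ψ a : ℝ) * f a := hm.mul hf
  rw [gaussianReal_of_var_ne_zero _ hΨ.ne', gaussianReal_of_var_ne_zero _ (prunedVar_pos hd hΨ).ne',
    lintegral_withDensity_eq_lintegral_mul _ (measurable_gaussianPDF _ _) hmf,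
    lintegral_withDensity_eq_lintegral_mul _ (measurable_gaussianPDF _ _) hf,
    ← lintegral_const_mul _ ((measurable_gaussianPDF _ _).mul hf)]
  refine lintegral_congr fun a => ?_
  simp only [Pi.mul_apply, gaussianPDF]
  rw [← mul_assoc, ← mul_assoc, ← ENNReal.ofReal_mul (gaussianPDFReal_nonneg _ _ _),
    gaussianPDFReal_mul_pruneProb hd hΨ, ENNReal.ofReal_mul (meanPruneProb d).2.1]

lemma lintegral_one_sub_pruneProb (hd : 0 < d) (hΨ : 0 < Ψ) :
    ∫⁻ a, ENNReal.ofReal (1 - pruneProb d Ψ a) ∂gaussianReal 0 Ψ =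
      ENNReal.ofReal (1 - meanPruneProb d) := by
  have hm : Measurable fun a => ENNReal.ofReal (pruneProb d Ψ a : ℝ) :=
    (measurable_subtype_coe.comp (continuous_pruneProb d Ψ).measurable).ennreal_ofReal
  have h1 : ∫⁻ a, ENNReal.ofReal (pruneProb d Ψ a) ∂gaussianReal 0 Ψ =
      ENNReal.ofReal (meanPruneProb d) := by
    simpa using lintegral_pruneProb_mul hd hΨ (f := fun _ => 1) measurable_const
  have h2 : ∫⁻ a, (ENNReal.ofReal (pruneProb d Ψ a) + ENNReal.ofReal (1 - pruneProb d Ψ a))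
      ∂gaussianReal 0 Ψ = 1 := by
    have h3 : ∀ a, ENNReal.ofReal (pruneProb d Ψ a) + ENNReal.ofReal (1 - pruneProb d Ψ a) = 1 :=
      fun a => by
        rw [← ENNReal.ofReal_add (pruneProb d Ψ a).2.1
          (unitInterval.one_minus_nonneg _), add_sub_cancel, ENNReal.ofReal_one]
    simp [h3]
  rw [lintegral_add_left hm, h1] at h2
  have h4 : ENNReal.ofReal (meanPruneProb d) + ENNReal.ofReal (1 - meanPruneProb d) = 1 := by
    rw [← ENNReal.ofReal_add (meanPruneProb d).2.1 (unitInterval.one_minus_nonneg _),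
      add_sub_cancel, ENNReal.ofReal_one]
  exact (ENNReal.add_right_inj ENNReal.ofReal_ne_top).1 (h2.trans h4.symm)

lemma measurable_prunedEntry (c : ℝ) :
    Measurable fun x : ℝ × Bool => if x.2 = true then x.1 / c else 0 :=
  Measurable.ite (measurable_snd (measurableSet_singleton true))
    (measurable_fst.div_const c) measurable_const

/-- A pruned Gaussian weight is a multiple of a product of independent Bernoulli and standard
Gaussian variables. -/
lemma hasLaw_prunedEntry (hd : 0 < d) (hΨ : 0 < Ψ) :
    HasLaw (fun x : ℝ × Bool => if x.2 = true then x.1 / √(prunedVar d Ψ : ℝ) else 0)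
      (sparseGaussian (meanPruneProb d)) (weightLaw d Ψ) where
  aemeasurable := (measurable_prunedEntry _).aemeasurable
  map_eq := by
    set c := √(prunedVar d Ψ : ℝ) with hc
    have hv : (0 : ℝ) < prunedVar d Ψ := prunedVar_pos hd hΨ
    refine Measure.ext_of_lintegral _ fun f hf => ?_
    have hm : Measurable fun x : ℝ × Bool => f (if x.2 = true then x.1 / c else 0) :=
      hf.comp (measurable_prunedEntry c)
    rw [lintegral_map hf (measurable_prunedEntry c), weightLaw, Measure.lintegral_compProd hm]
    have hk : ∀ a, ∫⁻ x, f (if x = true then a / c else 0) ∂(pruneKernel d Ψ a) =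
        ENNReal.ofReal (pruneProb d Ψ a) * f (a / c) +
          ENNReal.ofReal (1 - pruneProb d Ψ a) * f 0 := fun a => by
      have : pruneKernel d Ψ a = bernoulliMeasure true false (pruneProb d Ψ a) := rfl
      rw [this, lintegral_bernoulli]
      simp
    have hpm : Measurable fun a => (pruneProb d Ψ a : ℝ) :=
      measurable_subtype_coe.comp (continuous_pruneProb d Ψ).measurable
    have hfm : Measurable fun a => f (a / c) := hf.comp (measurable_id.div_const c)
    have hgauss : (gaussianReal 0 (prunedVar d Ψ)).map (· / c) = gaussianReal 0 1 := by
      rw [gaussianReal_map_div_const, zero_div]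
      congr 1
      ext
      simp only [NNReal.coe_div, NNReal.coe_mk, NNReal.coe_one, hc]
      rw [Real.sq_sqrt hv.le, div_self hv.ne']
    have hpf : Measurable fun a => ENNReal.ofReal (pruneProb d Ψ a : ℝ) * f (a / c) :=
      hpm.ennreal_ofReal.mul hfm
    have hqm : Measurable fun a => ENNReal.ofReal (1 - (pruneProb d Ψ a : ℝ)) :=
      (measurable_const.sub hpm).ennreal_ofReal
    simp only [hk]
    rw [lintegral_add_left hpf, lintegral_pruneProb_mul hd hΨ hfm,
      lintegral_mul_const _ hqm,
      lintegral_one_sub_pruneProb hd hΨ, sparseGaussian_eq, lintegral_add_measure,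
      lintegral_smul_measure, lintegral_smul_measure, lintegral_dirac, ← hgauss,
      lintegral_map hf (show Measurable fun x : ℝ => x / c from measurable_id.div_const c)]
    rfl

end PrunedEntry

/-! ### Pruning error of one layer -/

section Layer

variable {Ω : Type*} [MeasurableSpace Ω] {P : Measure Ω} {m k : ℕ}

/-- Transposition preserves the norm and the bound is symmetric in `m` and `k`, so the case `k ≤ m`
is enough. -/
lemma lintegral_opNorm_sq_of_hasLaw [IsProbabilityMeasure P] {p : unitInterval} (hp : (0 : ℝ) < p)
    (hm0 : 0 < m) (hk0 : 0 < k) {Y : Fin m × Fin k → Ω → ℝ}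
    (hY : ∀ q, HasLaw (Y q) (sparseGaussian p) P) (hind : iIndepFun Y P) :
    ∫⁻ ω, ENNReal.ofReal (‖(ofPairs fun q => Y q ω : Matrix (Fin m) (Fin k) ℝ)‖ ^ 2) ∂P ≤
      ENNReal.ofReal (23 * 10 ^ 4 * ((m + k) * p + √(m * k * p))) := by
  wlog hkm : k ≤ m generalizing m k Y
  · have h := this hk0 hm0 (Y := fun q => Y q.swap) (fun q => hY q.swap)
      (hind.precomp Prod.swap_injective) (by omega)
    have htr : ∀ ω, ‖(ofPairs fun q => Y q.swap ω : Matrix (Fin k) (Fin m) ℝ)‖ =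
        ‖(ofPairs fun q => Y q ω : Matrix (Fin m) (Fin k) ℝ)‖ := fun ω =>
      opNorm_transpose (ofPairs fun q => Y q ω : Matrix (Fin m) (Fin k) ℝ)
    simp only [htr] at h
    rwa [add_comm (k : ℝ), mul_comm (k : ℝ)] at h
  have hmap : P.map (fun ω q => Y q ω) = Measure.pi fun _ : Fin m × Fin k => sparseGaussian p := by
    rw [(iIndepFun_iff_map_fun_eq_pi_map fun q => (hY q).aemeasurable).1 hind]
    congr 1
    ext1 q
    exact (hY q).map_eq
  have hmeas : AEMeasurable (fun ω q => Y q ω) P := aemeasurable_pi_lambda _ fun q =>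
    (hY q).aemeasurable
  have h := lintegral_map' (μ := P) (g := fun ω q => Y q ω)
    (f := fun B : Fin m × Fin k → ℝ => ENNReal.ofReal (‖ofPairs B‖ ^ 2))
    measurable_opNorm_ofPairs_sq.ennreal_ofReal.aemeasurable hmeas
  rw [← h, hmap]
  refine (lintegral_opNorm_sq_sparse_le hp hk0 hkm).trans (ENNReal.ofReal_le_ofReal ?_)
  have : 0 ≤ (k : ℝ) * p := by positivity
  linarith

/-- The removed matrix is the off-diagonal part of the masked one, and deleting a diagonal at most
doubles the norm. -/
lemma opNorm_sub_prune_le {c : ℝ} (hc : 0 < c) (A : Matrix (Fin m) (Fin k) ℝ)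
    (X : Matrix (Fin m) (Fin k) Bool) :
    ‖A - prune A X‖ ≤ 2 * (c * ‖(ofPairs fun q =>
      if X q.1 q.2 = true then A q.1 q.2 / c else 0 : Matrix (Fin m) (Fin k) ℝ)‖) := by
  set Y : Matrix (Fin m) (Fin k) ℝ := ofPairs fun q =>
    if X q.1 q.2 = true then A q.1 q.2 / c else 0 with hY
  have h : A - prune A X = offDiagPart (c • Y) := by
    ext i j
    rw [Matrix.sub_apply]
    simp only [prune, offDiagPart, Matrix.smul_apply, hY, ofPairs, smul_eq_mul]
    by_cases h1 : (i : ℕ) = (j : ℕ) <;> by_cases h2 : X i j = true <;> simp [h1, h2]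
    field_simp
  rw [h]
  refine (opNorm_offDiagPart_le _).trans (le_of_eq ?_)
  rw [norm_smul, Real.norm_of_nonneg hc.le]

lemma Gam_nonneg {C : ℝ} (hC : 0 ≤ C) (d Ψ : ℝ≥0) (m k : ℕ) : 0 ≤ Gam C d Ψ m k := by
  unfold Gam
  positivity

/-- In terms of `p`, the two summands of `Γ` contain `p³ Ψ` and `p⁵ Ψ²`; their squares dominate `v
(m + k) p` and `v √(m k p)`. The constant 1000 is chosen so that `4 * 23 * 10 ^ 4 ≤ 1000 ^ 2`. -/
lemma sq_Gam_ge (d Ψ : ℝ≥0) (m k : ℕ) :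
    4 * prunedVar d Ψ * (23 * 10 ^ 4 * ((m + k) * (meanPruneProb d : ℝ) +
      √(m * k * (meanPruneProb d : ℝ)))) ≤ Gam 1000 d Ψ m k ^ 2 := by
  set p : ℝ := (meanPruneProb d : ℝ) with hp
  have hp0 : 0 ≤ p := (meanPruneProb d).2.1
  have hp1 : p ≤ 1 := (meanPruneProb d).2.2
  have hΨ : (0 : ℝ) ≤ Ψ := Ψ.2
  have hd : (0 : ℝ) ≤ d := d.2
  have hpow : ∀ a : ℕ, (d : ℝ) ^ ((a : ℝ) / 2) / ((d : ℝ) + 2) ^ ((a : ℝ) / 2) = p ^ a := by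
    intro a
    have hsq : p = ((d : ℝ) / (d + 2)) ^ (1 / 2 : ℝ) := by
      rw [hp, ← Real.sqrt_eq_rpow]; rfl
    rw [← Real.div_rpow hd (by positivity), hsq, ← Real.rpow_natCast, ← Real.rpow_mul
      (by positivity)]
    congr 1
    ring
  have h3 := hpow 3
  have h5 := hpow 5
  push_cast at h3 h5
  have hG : Gam 1000 d Ψ m k = 1000 * (√(p ^ 3 * Ψ) * (√(m : ℝ) + √(k : ℝ)) +
      (3 * (m * k * p ^ 5 * (Ψ : ℝ) ^ 2)) ^ (1 / 4 : ℝ)) := by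
    rw [Gam, ← h3, ← h5]
    congr 3
    · congr 2
      ring
    · ring
  set a := √(p ^ 3 * Ψ) * (√(m : ℝ) + √(k : ℝ)) with ha
  set b := (3 * (m * k * p ^ 5 * (Ψ : ℝ) ^ 2)) ^ (1 / 4 : ℝ) with hb
  have ha0 : 0 ≤ a := by positivity
  have hb0 : 0 ≤ b := by positivity
  have ha2 : Ψ * p ^ 2 * ((m + k) * p) ≤ a ^ 2 := by
    rw [ha, mul_pow, Real.sq_sqrt (by positivity)]
    have h1 : (m : ℝ) + k ≤ (√(m : ℝ) + √(k : ℝ)) ^ 2 := by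
      have e1 := Real.sq_sqrt (Nat.cast_nonneg (α := ℝ) m)
      have e2 := Real.sq_sqrt (Nat.cast_nonneg (α := ℝ) k)
      have e3 := mul_nonneg (Real.sqrt_nonneg (m : ℝ)) (Real.sqrt_nonneg (k : ℝ))
      nlinarith
    calc Ψ * p ^ 2 * ((m + k) * p) = p ^ 3 * Ψ * (m + k) := by ring
      _ ≤ _ := by gcongr
  have hb2 : Ψ * p ^ 2 * √(m * k * p) ≤ b ^ 2 := by
    have e1 : b ^ 2 = √(3 * (m * k * p ^ 5 * (Ψ : ℝ) ^ 2)) := by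
      rw [hb, ← Real.rpow_natCast, ← Real.rpow_mul (by positivity), Real.sqrt_eq_rpow]
      norm_num
    rw [e1]
    refine Real.le_sqrt_of_sq_le ?_
    rw [mul_pow, Real.sq_sqrt (by positivity)]
    have : 0 ≤ m * k * p ^ 5 * (Ψ : ℝ) ^ 2 := by positivity
    calc (Ψ * p ^ 2) ^ 2 * (m * k * p) = m * k * p ^ 5 * (Ψ : ℝ) ^ 2 := by ring
      _ ≤ _ := by linarith
  rw [hG, coe_prunedVar, ← hp]
  have hab : a ^ 2 + b ^ 2 ≤ (a + b) ^ 2 := by nlinarith [mul_nonneg ha0 hb0]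
  have : 0 ≤ (a + b) ^ 2 := sq_nonneg _
  nlinarith

/-- The pruning error of a Gaussian layer exceeds `ε Γ` with probability at most `1 / ε`. -/
lemma measure_opNorm_sub_prune_gt_le [IsProbabilityMeasure P] {d Ψ : ℝ≥0} (hd : 0 < d)
    (hΨ : 0 < Ψ) {A : Ω → Matrix (Fin m) (Fin k) ℝ} {X : Ω → Matrix (Fin m) (Fin k) Bool}
    (hA : IsGaussianLayer P d Ψ A X) {ε : ℝ} (hε : 0 < ε) :
    P {ω | ε * Gam 1000 d Ψ m k < ‖A ω - prune (A ω) (X ω)‖} ≤ ENNReal.ofReal ε⁻¹ := by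
  -- For `ε ≤ 1` the claim is trivial; for `ε > 1` Markov's inequality for the squared norm gives
  -- `ε⁻²`, which is smaller than `ε⁻¹`.
  rcases le_or_gt ε 1 with hε1 | hε1
  · refine prob_le_one.trans ?_
    rw [← ENNReal.ofReal_one]
    exact ENNReal.ofReal_le_ofReal ((one_le_inv₀ hε).2 hε1)
  have hG0 := Gam_nonneg (by norm_num : (0 : ℝ) ≤ 1000) d Ψ m k
  by_cases hmk : m = 0 ∨ k = 0
  · have hzero : ∀ B : Matrix (Fin m) (Fin k) ℝ, ‖B‖ = 0 := by
      intro B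
      have : B = 0 := by
        ext i j
        rcases hmk with rfl | rfl
        · exact i.elim0
        · exact j.elim0
      rw [this, norm_zero]
    have hempty : {ω | ε * Gam 1000 d Ψ m k < ‖A ω - prune (A ω) (X ω)‖} = ∅ := by
      ext ω
      have : 0 ≤ ε * Gam 1000 d Ψ m k := by positivity
      simp [hzero, this]
    rw [hempty, measure_empty]
    exact zero_le
  push Not at hmk
  have hm0 : 0 < m := Nat.pos_of_ne_zero hmk.1
  have hk0 : 0 < k := Nat.pos_of_ne_zero hmk.2
  set c := √(prunedVar d Ψ : ℝ) with hc
  have hv : (0 : ℝ) < prunedVar d Ψ := prunedVar_pos hd hΨ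
  have hc0 : 0 < c := Real.sqrt_pos.2 hv
  have hc2 : c ^ 2 = prunedVar d Ψ := Real.sq_sqrt hv.le
  set Y : Fin m × Fin k → Ω → ℝ := fun q ω =>
    if X ω q.1 q.2 = true then A ω q.1 q.2 / c else 0 with hYdef
  have hY : ∀ q, HasLaw (Y q) (sparseGaussian (meanPruneProb d)) P := fun q =>
    (hasLaw_prunedEntry hd hΨ).comp (hA.hasLaw q.1 q.2)
  have hYind : iIndepFun Y P :=
    hA.indep.comp (fun _ x => if x.2 = true then x.1 / c else 0) fun _ => measurable_prunedEntry c
  have hp := meanPruneProb_pos hd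
  have hint := lintegral_opNorm_sq_of_hasLaw hp hm0 hk0 hY hYind
  set S := 23 * 10 ^ 4 * (((m : ℝ) + k) * (meanPruneProb d : ℝ) +
    √(m * k * (meanPruneProb d : ℝ))) with hS
  have hmpos : (0 : ℝ) < m := by exact_mod_cast hm0
  have hS0 : 0 < S := by positivity
  have hGS : 4 * prunedVar d Ψ * S ≤ Gam 1000 d Ψ m k ^ 2 := sq_Gam_ge d Ψ m k
  have hmeas : AEMeasurable (fun ω => ENNReal.ofReal
      (‖(ofPairs fun q => Y q ω : Matrix (Fin m) (Fin k) ℝ)‖ ^ 2)) P :=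
    measurable_opNorm_ofPairs_sq.ennreal_ofReal.comp_aemeasurable
      (aemeasurable_pi_lambda _ fun q => (hY q).aemeasurable)
  have hsub : {ω | ε * Gam 1000 d Ψ m k < ‖A ω - prune (A ω) (X ω)‖} ⊆
      {ω | ENNReal.ofReal (ε ^ 2 * S) ≤ ENNReal.ofReal
        (‖(ofPairs fun q => Y q ω : Matrix (Fin m) (Fin k) ℝ)‖ ^ 2)} := by
    intro ω hω
    have h1 : ε * Gam 1000 d Ψ m k <
        2 * (c * ‖(ofPairs fun q => Y q ω : Matrix (Fin m) (Fin k) ℝ)‖) :=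
      lt_of_lt_of_le hω (opNorm_sub_prune_le hc0 (A ω) (X ω))
    set N := ‖(ofPairs fun q => Y q ω : Matrix (Fin m) (Fin k) ℝ)‖
    refine ENNReal.ofReal_le_ofReal ?_
    have h2 : (ε * Gam 1000 d Ψ m k) ^ 2 ≤ (2 * (c * N)) ^ 2 := by gcongr
    have h3 : (2 * (c * N)) ^ 2 = 4 * prunedVar d Ψ * N ^ 2 := by rw [← hc2]; ring
    rw [h3, mul_pow] at h2
    have h4 : ε ^ 2 * (4 * prunedVar d Ψ * S) ≤ 4 * prunedVar d Ψ * N ^ 2 :=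
      (mul_le_mul_of_nonneg_left hGS (sq_nonneg ε)).trans h2
    have h5 : 4 * (prunedVar d Ψ : ℝ) * (ε ^ 2 * S) ≤ 4 * prunedVar d Ψ * N ^ 2 := by linarith
    exact le_of_mul_le_mul_left h5 (by positivity)
  have hmarkov := mul_meas_ge_le_lintegral₀ hmeas (ENNReal.ofReal (ε ^ 2 * S))
  have hpos : ENNReal.ofReal (ε ^ 2 * S) ≠ 0 := by
    rw [Ne, ENNReal.ofReal_eq_zero, not_le]
    positivity
  calc _ ≤ P {ω | ENNReal.ofReal (ε ^ 2 * S) ≤ ENNReal.ofReal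
        (‖(ofPairs fun q => Y q ω : Matrix (Fin m) (Fin k) ℝ)‖ ^ 2)} := measure_mono hsub
    _ ≤ ENNReal.ofReal S / ENNReal.ofReal (ε ^ 2 * S) := by
      rw [ENNReal.le_div_iff_mul_le (Or.inl hpos) (Or.inl ENNReal.ofReal_ne_top), mul_comm]
      exact hmarkov.trans hint
    _ = ENNReal.ofReal (S / (ε ^ 2 * S)) := (ENNReal.ofReal_div_of_pos (by positivity)).symm
    _ ≤ ENNReal.ofReal ε⁻¹ := by
      refine ENNReal.ofReal_le_ofReal ?_
      rw [div_le_iff₀ (by positivity)]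
      have : ε⁻¹ * (ε ^ 2 * S) = ε * S := by field_simp
      rw [this]
      nlinarith

end Layer

end MagnitudePruning

/-! ### The network bound -/

theorem mainTheorem6 :
    ∃ C : ℝ, 0 < C ∧
      ∀ {Ω : Type*} [MeasurableSpace Ω] (P : Measure Ω) [IsProbabilityMeasure P]
        (L : ℕ) (n : ℕ → ℕ) (d Ψ : ℝ≥0) (_hd : 0 < d) (_hΨ : 0 < Ψ)
        -- the random weights and the random pruning indicators
        (A : (l : ℕ) → Ω → Matrix (Fin (n (l + 1))) (Fin (n l)) ℝ)
        (X : (l : ℕ) → Ω → Matrix (Fin (n (l + 1))) (Fin (n l)) Bool)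
        (_hA : ∀ l < L, MagnitudePruning.IsGaussianLayer P d Ψ (A l) (X l))
        -- the activations and their Lipschitz constants; the last layer has no activation
        (φ : (l : ℕ) →
          EuclideanSpace ℝ (Fin (n (l + 1))) → EuclideanSpace ℝ (Fin (n (l + 1))))
        (Lip : ℕ → ℝ≥0)
        (_hφ : ∀ l, l + 1 < L → LipschitzWith (Lip l) (φ l))
        (_hφ0 : ∀ l, l + 1 < L → φ l 0 = 0)
        (_hLip : ∀ l, l + 1 = L → Lip l = 1),
        -- discretization error of a single layer
        (∀ l < L, ∀ (ω : Ω) (ρ : ℝ), 0 < ρ →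
          ‖MagnitudePruning.discretize ρ (MagnitudePruning.prune (A l ω) (X l ω)) -
              MagnitudePruning.prune (A l ω) (X l ω)‖ ≤
            ρ * MagnitudePruning.numNonzero (MagnitudePruning.prune (A l ω) (X l ω))) ∧
        -- error of the network output
        ∀ ε : ℕ → ℝ, (∀ l < L, 0 < ε l) →
          ∃ E : Set Ω, MeasurableSet E ∧
            1 - ∑ l ∈ Finset.range L, (ε l)⁻¹ ≤ P.real E ∧
            ∀ ω ∈ E, ∀ ρ : ℕ → ℝ,
              (∀ l < L, 0 < ρ l ∧
                ρ l ≤ (1 / (L : ℝ) * ‖A l ω‖ -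
                    ε l * MagnitudePruning.Gam C d Ψ (n (l + 1)) (n l)) /
                  MagnitudePruning.numNonzero (MagnitudePruning.prune (A l ω) (X l ω))) →
              ∀ x : EuclideanSpace ℝ (Fin (n 0)), ‖x‖ ≤ n 0 →
                ‖MagnitudePruning.layerOutput (fun l => A l ω) φ x L -
                    MagnitudePruning.layerOutput
                      (fun l => MagnitudePruning.discretize (ρ l)
                        (MagnitudePruning.prune (A l ω) (X l ω))) φ x L‖ ≤
                  Real.exp 1 * n 0 * (∏ l ∈ Finset.range L, (Lip l : ℝ) * ‖A l ω‖) *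
                    ∑ l ∈ Finset.range L,
                      (ε l * MagnitudePruning.Gam C d Ψ (n (l + 1)) (n l) +
                        ρ l * MagnitudePruning.numNonzero
                          (MagnitudePruning.prune (A l ω) (X l ω))) / ‖A l ω‖ := by
  refine ⟨1000, by norm_num, ?_⟩
  intro Ω _ P _ L n d Ψ hd hΨ A X hA φ Lip hφ hφ0 hLip
  refine ⟨fun l _ ω ρ hρ => MagnitudePruning.norm_discretize_sub_le _ hρ, ?_⟩
  intro ε hε
  -- The weights are only almost everywhere measurable, so measurable hulls of the bad events are
  -- used; they have the same probability.
  set bad : ℕ → Set Ω := fun l => toMeasurable P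
    {ω | ε l * MagnitudePruning.Gam 1000 d Ψ (n (l + 1)) (n l) <
      ‖A l ω - MagnitudePruning.prune (A l ω) (X l ω)‖} with hbad
  have hbadP : ∀ l ∈ Finset.range L, P.real (bad l) ≤ (ε l)⁻¹ := by
    intro l hl
    have hl' := Finset.mem_range.1 hl
    refine ENNReal.toReal_le_of_le_ofReal (inv_nonneg.2 (hε l hl').le) ?_
    rw [hbad, measure_toMeasurable]
    exact MagnitudePruning.measure_opNorm_sub_prune_gt_le hd hΨ (hA l hl') (hε l hl')
  have hmeas : MeasurableSet (⋃ l ∈ Finset.range L, bad l) :=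
    Finset.measurableSet_biUnion _ fun l _ => measurableSet_toMeasurable _ _
  refine ⟨(⋃ l ∈ Finset.range L, bad l)ᶜ, hmeas.compl, ?_, ?_⟩
  · rw [probReal_compl_eq_one_sub hmeas]
    have h := measureReal_biUnion_finset_le (μ := P) (Finset.range L) bad
    linarith [Finset.sum_le_sum hbadP]
  intro ω hω ρ hρ x hx
  have hgood : ∀ l < L, ‖A l ω - MagnitudePruning.prune (A l ω) (X l ω)‖ ≤
      ε l * MagnitudePruning.Gam 1000 d Ψ (n (l + 1)) (n l) := by
    intro l hl
    by_contra hcon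
    push Not at hcon
    exact hω (Set.mem_biUnion (Finset.mem_coe.2 (Finset.mem_range.2 hl))
      (subset_toMeasurable P _ hcon))
  have hkey : ∀ l < L, 0 < ‖A l ω‖ ∧
      ε l * MagnitudePruning.Gam 1000 d Ψ (n (l + 1)) (n l) +
        ρ l * MagnitudePruning.numNonzero (MagnitudePruning.prune (A l ω) (X l ω)) ≤
      1 / (L : ℝ) * ‖A l ω‖ := by
    intro l hl
    obtain ⟨hρ0, hρ1⟩ := hρ l hl
    have hG : 0 ≤ ε l * MagnitudePruning.Gam 1000 d Ψ (n (l + 1)) (n l) :=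
      mul_nonneg (hε l hl).le (MagnitudePruning.Gam_nonneg (by norm_num) _ _ _ _)
    -- If no entry is nonzero, division by zero makes the upper bound on `ρ l` equal to 0,
    -- contradicting `0 < ρ l`; so the hypothesis forces at least one nonzero entry.
    rcases Nat.eq_zero_or_pos
      (MagnitudePruning.numNonzero (MagnitudePruning.prune (A l ω) (X l ω))) with hJ | hJ
    · rw [hJ, Nat.cast_zero, div_zero] at hρ1
      linarith
    have hJ' : (0 : ℝ) <
        MagnitudePruning.numNonzero (MagnitudePruning.prune (A l ω) (X l ω)) := by
      exact_mod_cast hJ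
    rw [le_div_iff₀ hJ'] at hρ1
    have hpos := mul_pos hρ0 hJ'
    refine ⟨?_, by linarith⟩
    by_contra hcon
    have h0 : ‖A l ω‖ = 0 := le_antisymm (not_lt.1 hcon) (norm_nonneg _)
    rw [h0, mul_zero] at hρ1
    linarith
  refine (MagnitudePruning.norm_output_sub_le (A := fun l => A l ω) (Lip := Lip) hφ hφ0 hLip
    (δ := fun l => ε l * MagnitudePruning.Gam 1000 d Ψ (n (l + 1)) (n l) +
      ρ l * MagnitudePruning.numNonzero (MagnitudePruning.prune (A l ω) (X l ω)))
    (fun l hl => (hkey l hl).1) (fun l hl => ?_) (fun l hl => (hkey l hl).2) x).trans ?_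
  · have h1 := MagnitudePruning.norm_discretize_sub_le
      (MagnitudePruning.prune (A l ω) (X l ω)) (hρ l hl).1
    have h2 := norm_sub_le_norm_sub_add_norm_sub (A l ω)
      (MagnitudePruning.prune (A l ω) (X l ω))
      (MagnitudePruning.discretize (ρ l) (MagnitudePruning.prune (A l ω) (X l ω)))
    rw [norm_sub_rev (MagnitudePruning.prune (A l ω) (X l ω))] at h2
    linarith [hgood l hl]
  · have hP : 0 ≤ ∏ l ∈ Finset.range L, (Lip l : ℝ) * ‖A l ω‖ :=
      MagnitudePruning.prod_lip_mul_norm_nonneg (fun l => A l ω) Lip L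
    have hS : 0 ≤ ∑ l ∈ Finset.range L,
        (ε l * MagnitudePruning.Gam 1000 d Ψ (n (l + 1)) (n l) +
          ρ l * MagnitudePruning.numNonzero (MagnitudePruning.prune (A l ω) (X l ω))) /
          ‖A l ω‖ :=
      Finset.sum_nonneg fun l hl => by
        have hl' := Finset.mem_range.1 hl
        exact div_nonneg (add_nonneg (mul_nonneg (hε l hl').le
          (MagnitudePruning.Gam_nonneg (by norm_num) _ _ _ _))
          (mul_nonneg (hρ l hl').1.le (Nat.cast_nonneg _))) (norm_nonneg _)
    exact mul_le_mul_of_nonneg_right (mul_le_mul_of_nonneg_right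
      (mul_le_mul_of_nonneg_left hx (Real.exp_pos 1).le) hP) hS
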